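/- Let $n\ge 2$, $1<p<\infty$, let $\Omega\subset\mathbb R^n$ be bounded and open, and let $\sigma\in L^\infty(\Omega;\mathbb R)$ satisfy $\operatorname{ess\,inf}_\Omega\sigma>0$ and either $\sigma\ge 1$ a.e. in $\Omega$ or $\sigma\le 1$ a.e. in $\Omega$. **Notation.** Let $m$ be Lebesgue measure and $X=W^{1,p}(\Omega)/W^{1,p}_0(\Omega)$. The Dirichlet-to-Neumann map $\Lambda_\sigma:X\to X'$ is $$\langle\Lambda_\sigma(f),g\rangle=\int_\Omega\sigma|\nabla u|^{p-2}\nabla u\cdot\nabla v\,dx ,$$ where $u$ is the minimizer of $E_\sigma(u)=\int_\Omega\sigma|\nabla u|^p\,dx$ among the functions in $W^{1,p}(\Omega)$ with class $f$ in $X$, and $v\in W^{1,p}(\Omega)$ is any representative of $g$. $\Lambda_1$ is the map for $\sigma\equiv 1$. The inclusion $D=\operatorname{supp}(\sigma-1)$ is the complement in $\Omega$ of the union of all open sets $O\subseteq\Omega$ on which $\sigma=1$ a.e. For measurable $A\subset\mathbb R^n$, $\operatorname{cessco}A$ is the intersection of all half-spaces $\{x: x\cdot\rho\le t\}$ ($\rho\in\mathbb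 R^n$, $t\in\mathbb R$) with $m(A\setminus\{x: x\cdot\rho\le t\})=0$. If $A$ is bounded and $m(A)>0$, put $h_A(\rho)=\inf\{t\in\mathbb R: m(A\setminus\{x: x\cdot\rho\le t\})=0\}$. Let $(a_0,b_0)\in\mathbb R^2\setminus\{(0,0)\}$ and consider the initial value problem on $\mathbb R$ $$w''+\frac{(2p-3)(w')^2+(p-1)w^2}{(p-1)(w')^2+w^2}\,w=0,\qquad w(0)=a_0,\quad w'(0)=b_0. \tag{1}$$ Given a solution $w$ of (1), choose for each unit vector $\rho$ a unit vector $\rho^\perp$ with $\rho\cdot\rho^\perp=0$. For $t\in\mathbb R$ and $\tau>0$ let $f_\tau\in X$ be the boundary value (class in $X$) of the Wolff solution $u_\tau(x)=e^{\tau(x\cdot\rho-t)}\,w(\tau\,x\cdot\rho^\perp)$, and put $$I_\rho(t,\tau)=\tau^{-p}\langle(\Lambda_\sigma-\Lambda_1)(f_\tau),f_\tau\rangle,\qquad H_\rho=\{x\in\mathbb R^n:\ |I_\rho(x\cdot\rho,\tau)|\to\infty\text{ as }\tau\to\infty\}.$$ **Theorem.** Problem (1) has a solution $w\in C^\infty(\mathbb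 R)$. For every such solution and every choice of the vectors $\rho^\perp$, $$\operatorname{cessco}D=\bigcap_{\rho\in\mathbb R^n,\ |\rho|=1}\overline{H_\rho}.$$ Moreover, if $m(D)>0$, then for every unit vector $\rho$: * $I_\rho(t,\tau)\to 0$ as $\tau\to\infty$ for every $t>h_D(\rho)$; * for every $t<h_D(\rho)$, as $\tau\to\infty$, $I_\rho(t,\tau)\to+\infty$ if $\sigma\ge 1$ a.e., and $I_\rho(t,\tau)\to-\infty$ if $\sigma\le 1$ a.e. -/

import Mathlib

open MeasureTheory Filter Topology
open scoped ContDiff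

noncomputable section

namespace PConductivity

/-- `ℝⁿ` with its Euclidean norm. -/
abbrev Eu (n : ℕ) : Type := EuclideanSpace ℝ (Fin n)

instance factOneLe (p : ℝ) [hp : Fact (1 < p)] : Fact (1 ≤ ENNReal.ofReal p) :=
  ⟨ENNReal.one_le_ofReal.2 hp.out.le⟩

/-! ### Essential support, half-spaces, essential convex hull -/

/-- The essential support of `f : Ω → ℝ`: the points of `Ω` outside every open set `O ⊆ Ω` on which
`f` vanishes almost everywhere. -/
def essSupp {n : ℕ} (Ω : Set (Eu n)) (f : Eu n → ℝ) : Set (Eu n) :=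
  Ω \ ⋃₀ {O | IsOpen O ∧ O ⊆ Ω ∧ ∀ᵐ x ∂(volume.restrict O), f x = 0}

/-- The closed half-space `{x | x · ρ ≤ t}`. -/
def halfSpace {n : ℕ} (ρ : Eu n) (t : ℝ) : Set (Eu n) := {x | inner ℝ x ρ ≤ t}

/-- The closed essential convex hull. -/
def cessco {n : ℕ} (A : Set (Eu n)) : Set (Eu n) :=
  {x | ∀ (ρ : Eu n) (t : ℝ), volume (A \ halfSpace ρ t) = 0 → x ∈ halfSpace ρ t}

/-- The essential convex support function `h_A` (meaningful if `A` is bounded and not null). -/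
def essSupportFun {n : ℕ} (A : Set (Eu n)) (ρ : Eu n) : ℝ :=
  sInf {t : ℝ | volume (A \ halfSpace ρ t) = 0}

/-! ### Conductivities -/

/-- `σ ∈ L^∞₊(Ω)`: essentially bounded on `Ω`, with positive essential infimum. -/
def LInftyPlus {n : ℕ} (Ω : Set (Eu n)) (σ : Eu n → ℝ) : Prop :=
  MemLp σ ⊤ (volume.restrict Ω) ∧ ∃ c : ℝ, 0 < c ∧ ∀ᵐ x ∂(volume.restrict Ω), c ≤ σ x

/-! ### Sobolev spaces and boundary values -/

/-- `φ ∈ C_c^∞(Ω)`. -/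
def IsTest {n : ℕ} (Ω : Set (Eu n)) (φ : Eu n → ℝ) : Prop :=
  ContDiff ℝ ∞ φ ∧ HasCompactSupport φ ∧ tsupport φ ⊆ Ω

/-- `G` is the weak gradient of `u` in `Ω`: `∫ u ∂_v φ = - ∫ φ (G · v)` for all test functions `φ`
and all directions `v`. -/
def IsWeakGrad {n : ℕ} (Ω : Set (Eu n)) (u : Eu n → ℝ) (G : Eu n → Eu n) : Prop :=
  ∀ φ : Eu n → ℝ, IsTest Ω φ → ∀ v : Eu n,
    ∫ x in Ω, u x * fderiv ℝ φ x v = - ∫ x in Ω, φ x * inner ℝ (G x) v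

theorem IsTest.integrable_mul_fderiv {n : ℕ} {Ω : Set (Eu n)} {φ : Eu n → ℝ} (hφ : IsTest Ω φ)
    (v : Eu n) (p : ℝ) [Fact (1 < p)] (u : Lp ℝ (ENNReal.ofReal p) (volume.restrict Ω)) :
    Integrable (fun x => u x * fderiv ℝ φ x v) (volume.restrict Ω) := by
  have hc : Continuous (fun x => fderiv ℝ φ x v) :=
    (hφ.1.continuous_fderiv (by simp)).clm_apply continuous_const
  have hs : HasCompactSupport (fun x => fderiv ℝ φ x v) := hφ.2.1.fderiv_apply ℝ v
  have hu : LocallyIntegrable u (volume.restrict Ω) :=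
    (Lp.memLp u).locallyIntegrable (Fact.out : 1 ≤ ENNReal.ofReal p)
  simpa [mul_comm] using hu.integrable_smul_left_of_hasCompactSupport hc hs

theorem IsTest.integrable_mul_inner {n : ℕ} {Ω : Set (Eu n)} {φ : Eu n → ℝ} (hφ : IsTest Ω φ)
    (v : Eu n) (p : ℝ) [Fact (1 < p)] (G : Lp (Eu n) (ENNReal.ofReal p) (volume.restrict Ω)) :
    Integrable (fun x => φ x * inner ℝ (G x) v) (volume.restrict Ω) := by
  have hu : LocallyIntegrable G (volume.restrict Ω) :=
    (Lp.memLp G).locallyIntegrable (Fact.out : 1 ≤ ENNReal.ofReal p)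
  have h := (hu.integrable_smul_left_of_hasCompactSupport hφ.1.continuous hφ.2.1).inner_const
    (𝕜 := ℝ) v
  simpa [inner_smul_left] using h

/-- The Sobolev space `W^{1,p}(Ω)`: pairs of a function `u ∈ L^p(Ω)` and its weak gradient
`∇u ∈ L^p(Ω; ℝⁿ)`. The norm is the maximum of the two `L^p` norms, which is equivalent to the usual
Sobolev norm. -/
def W1p (p : ℝ) [Fact (1 < p)] {n : ℕ} (Ω : Set (Eu n)) :
    Submodule ℝ (Lp ℝ (ENNReal.ofReal p) (volume.restrict Ω) ×
      Lp (Eu n) (ENNReal.ofReal p) (volume.restrict Ω)) where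
  carrier := {U | IsWeakGrad Ω U.1 U.2}
  zero_mem' := by
    intro φ hφ v
    have h1 : ∫ x in Ω, ((0 : Lp ℝ (ENNReal.ofReal p) (volume.restrict Ω)) x) * fderiv ℝ φ x v
        = 0 := by
      rw [integral_eq_zero_of_ae]
      filter_upwards [Lp.coeFn_zero ℝ (ENNReal.ofReal p) (volume.restrict Ω)] with x hx
      rw [hx]; simp
    have h2 : ∫ x in Ω, φ x * inner ℝ ((0 : Lp (Eu n) (ENNReal.ofReal p) (volume.restrict Ω)) x) v
        = 0 := by
      rw [integral_eq_zero_of_ae]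
      filter_upwards [Lp.coeFn_zero (Eu n) (ENNReal.ofReal p) (volume.restrict Ω)] with x hx
      rw [hx]; simp
    simp only [Prod.fst_zero, Prod.snd_zero]
    rw [h1, h2, neg_zero]
  add_mem' := by
    intro U V hU hV φ hφ v
    have h1 : ∫ x in Ω, (U + V).1 x * fderiv ℝ φ x v
        = (∫ x in Ω, U.1 x * fderiv ℝ φ x v) + ∫ x in Ω, V.1 x * fderiv ℝ φ x v := by
      rw [← integral_add (hφ.integrable_mul_fderiv v p U.1) (hφ.integrable_mul_fderiv v p V.1)]
      refine integral_congr_ae ?_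
      filter_upwards [Lp.coeFn_add U.1 V.1] with x hx
      simp only [Prod.fst_add, hx, Pi.add_apply]
      ring
    have h2 : ∫ x in Ω, φ x * inner ℝ ((U + V).2 x) v
        = (∫ x in Ω, φ x * inner ℝ (U.2 x) v) + ∫ x in Ω, φ x * inner ℝ (V.2 x) v := by
      rw [← integral_add (hφ.integrable_mul_inner v p U.2) (hφ.integrable_mul_inner v p V.2)]
      refine integral_congr_ae ?_
      filter_upwards [Lp.coeFn_add U.2 V.2] with x hx
      simp only [Prod.snd_add, hx, Pi.add_apply, inner_add_left]
      ring
    rw [h1, h2, hU φ hφ v, hV φ hφ v]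
    ring
  smul_mem' := by
    intro c U hU φ hφ v
    have h1 : ∫ x in Ω, (c • U).1 x * fderiv ℝ φ x v
        = c * ∫ x in Ω, U.1 x * fderiv ℝ φ x v := by
      rw [← integral_const_mul]
      refine integral_congr_ae ?_
      filter_upwards [Lp.coeFn_smul c U.1] with x hx
      simp only [Prod.smul_fst, hx, Pi.smul_apply, smul_eq_mul]
      ring
    have h2 : ∫ x in Ω, φ x * inner ℝ ((c • U).2 x) v
        = c * ∫ x in Ω, φ x * inner ℝ (U.2 x) v := by
      rw [← integral_const_mul]
      refine integral_congr_ae ?_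
      filter_upwards [Lp.coeFn_smul c U.2] with x hx
      simp only [Prod.smul_snd, hx, Pi.smul_apply, real_inner_smul_left]
      ring
    rw [h1, h2, hU φ hφ v]
    ring

/-- The underlying function of an element of `W^{1,p}(Ω)`. -/
def sobFn {p : ℝ} [Fact (1 < p)] {n : ℕ} {Ω : Set (Eu n)} (u : W1p p Ω) : Eu n → ℝ :=
  u.1.1

/-- The weak gradient of an element of `W^{1,p}(Ω)`. -/
def sobGrad {p : ℝ} [Fact (1 < p)] {n : ℕ} {Ω : Set (Eu n)} (u : W1p p Ω) : Eu n → Eu n :=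
  u.1.2

/-- The elements of `W^{1,p}(Ω)` that are represented by functions in `C_c^∞(Ω)`. -/
def testSubmodule (p : ℝ) [Fact (1 < p)] {n : ℕ} (Ω : Set (Eu n)) : Submodule ℝ (W1p p Ω) where
  carrier := {u | ∃ φ : Eu n → ℝ, IsTest Ω φ ∧ sobFn u =ᵐ[volume.restrict Ω] φ}
  zero_mem' := by
    refine ⟨fun _ => 0, ⟨contDiff_const, HasCompactSupport.zero, ?_⟩, ?_⟩
    · simp [tsupport, Function.support]
    · exact Lp.coeFn_zero ℝ (ENNReal.ofReal p) (volume.restrict Ω)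
  add_mem' := by
    rintro u v ⟨φ, hφ, hu⟩ ⟨ψ, hψ, hv⟩
    refine ⟨φ + ψ, ⟨hφ.1.add hψ.1, hφ.2.1.add hψ.2.1, ?_⟩, ?_⟩
    · exact (tsupport_add φ ψ).trans (Set.union_subset hφ.2.2 hψ.2.2)
    · exact (Lp.coeFn_add u.1.1 v.1.1).trans (hu.add hv)
  smul_mem' := by
    rintro c u ⟨φ, hφ, hu⟩
    refine ⟨c • φ, ⟨hφ.1.const_smul c, hφ.2.1.smul_left (f := fun _ => c), ?_⟩, ?_⟩
    · exact (tsupport_smul_subset_right (fun _ => c) φ).trans hφ.2.2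
    · exact (Lp.coeFn_smul c u.1.1).trans (hu.const_smul c)

/-- `W_0^{1,p}(Ω)`: the closure of `C_c^∞(Ω)` in `W^{1,p}(Ω)`. -/
def W01p (p : ℝ) [Fact (1 < p)] {n : ℕ} (Ω : Set (Eu n)) : Submodule ℝ (W1p p Ω) :=
  (testSubmodule p Ω).topologicalClosure

/-- The space of boundary values `X = W^{1,p}(Ω) / W_0^{1,p}(Ω)`. -/
abbrev BdrySpace (p : ℝ) [Fact (1 < p)] {n : ℕ} (Ω : Set (Eu n)) : Type :=
  W1p p Ω ⧸ W01p p Ω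

/-- The boundary value in `X` of an element of `W^{1,p}(Ω)`. -/
def bdryTrace (p : ℝ) [Fact (1 < p)] {n : ℕ} (Ω : Set (Eu n)) (v : W1p p Ω) : BdrySpace p Ω :=
  (W01p p Ω).mkQ v

open Classical in
/-- The boundary value in `X` of a function `u` whose restriction to `Ω` lies in `W^{1,p}(Ω)`
(and `0` for all other functions). -/
def bdryValue (p : ℝ) [Fact (1 < p)] {n : ℕ} (Ω : Set (Eu n)) (u : Eu n → ℝ) : BdrySpace p Ω :=
  if h : ∃ v : W1p p Ω, sobFn v =ᵐ[volume.restrict Ω] u then bdryTrace p Ω h.choose else 0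

/-! ### The Dirichlet-to-Neumann map -/

/-- The energy `E_σ(u) = ∫_Ω σ |∇u|^p`. -/
def energy {p : ℝ} [Fact (1 < p)] {n : ℕ} {Ω : Set (Eu n)} (σ : Eu n → ℝ) (u : W1p p Ω) : ℝ :=
  ∫ x in Ω, σ x * ‖sobGrad u x‖ ^ p

/-- `u` minimizes `E_σ` among the elements of `W^{1,p}(Ω)` with boundary value `f`. -/
def IsMinimizer {p : ℝ} [Fact (1 < p)] {n : ℕ} {Ω : Set (Eu n)} (σ : Eu n → ℝ)
    (f : BdrySpace p Ω) (u : W1p p Ω) : Prop :=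
  bdryTrace p Ω u = f ∧ ∀ v : W1p p Ω, bdryTrace p Ω v = f → energy σ u ≤ energy σ v

/-- `ℓ ∈ X'` is the functional `[v] ↦ ∫_Ω σ |∇u|^{p-2} ∇u · ∇v`, where `u` is the minimizer with
boundary value `f`. -/
def IsDNValue {p : ℝ} [Fact (1 < p)] {n : ℕ} {Ω : Set (Eu n)} (σ : Eu n → ℝ)
    (f : BdrySpace p Ω) (ℓ : StrongDual ℝ (BdrySpace p Ω)) : Prop :=
  ∃ u : W1p p Ω, IsMinimizer σ f u ∧ ∀ v : W1p p Ω,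
    ℓ (bdryTrace p Ω v) = ∫ x in Ω, σ x * ‖sobGrad u x‖ ^ (p - 2) * inner ℝ (sobGrad u x) (sobGrad v x)

open Classical in
/-- The Dirichlet-to-Neumann map `Λ_σ : X → X'`. For bounded open `Ω` and `σ ∈ L^∞₊(Ω)` there is
exactly one `ℓ` with `IsDNValue σ f ℓ`; the value `0` in the other case plays no role. -/
def dnMap (p : ℝ) [Fact (1 < p)] {n : ℕ} (Ω : Set (Eu n)) (σ : Eu n → ℝ) (f : BdrySpace p Ω) :
    StrongDual ℝ (BdrySpace p Ω) :=
  if h : ∃ ℓ : StrongDual ℝ (BdrySpace p Ω), IsDNValue σ f ℓ then h.choose else 0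

/-! ### Wolff solutions and the indicator function -/

/-- The function `V` in the ordinary differential equation of the Wolff profiles. -/
def wolffV (p a b : ℝ) : ℝ :=
  ((2 * p - 3) * b ^ 2 + (p - 1) * a ^ 2) / ((p - 1) * b ^ 2 + a ^ 2)

/-- `w` is a smooth solution on `ℝ` of `w'' + V(w, w') w = 0`, `w(0) = a₀`, `w'(0) = b₀`. -/
def IsWolffProfile (p a₀ b₀ : ℝ) (w : ℝ → ℝ) : Prop :=
  ContDiff ℝ ∞ w ∧ (∀ s : ℝ, deriv (deriv w) s + wolffV p (w s) (deriv w s) * w s = 0) ∧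
    w 0 = a₀ ∧ deriv w 0 = b₀

/-- The Wolff solution `u_τ(x) = e^{τ (x · ρ - t)} w(τ x · ρ^⊥)`. -/
def wolffSol {n : ℕ} (w : ℝ → ℝ) (ρ ρperp : Eu n) (t τ : ℝ) (x : Eu n) : ℝ :=
  Real.exp (τ * (inner ℝ x ρ - t)) * w (τ * inner ℝ x ρperp)

/-- The indicator function `I_ρ(t, τ) = τ^{-p} ⟨(Λ_σ - Λ_1)(f_τ), f_τ⟩`, where `f_τ` is the boundary
value of `u_τ`. -/
def indicatorFun (p : ℝ) [Fact (1 < p)] {n : ℕ} (Ω : Set (Eu n)) (σ : Eu n → ℝ) (w : ℝ → ℝ)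
    (ρ ρperp : Eu n) (t τ : ℝ) : ℝ :=
  τ ^ (-p) *
    (dnMap p Ω σ (bdryValue p Ω (wolffSol w ρ ρperp t τ))
      - dnMap p Ω (fun _ => 1) (bdryValue p Ω (wolffSol w ρ ρperp t τ)))
      (bdryValue p Ω (wolffSol w ρ ρperp t τ))

/-- `H_ρ`: the points `x` for which `|I_ρ(x · ρ, τ)| → ∞` as `τ → ∞`. -/
def blowUpSet (p : ℝ) [Fact (1 < p)] {n : ℕ} (Ω : Set (Eu n)) (σ : Eu n → ℝ) (w : ℝ → ℝ)
    (ρ ρperp : Eu n) : Set (Eu n) :=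
  {x | Tendsto (fun τ : ℝ => |indicatorFun p Ω σ w ρ ρperp (inner ℝ x ρ) τ|) atTop atTop}

end PConductivity

end

open PConductivity

noncomputable section

namespace PConductivity

/-! ### Pointwise inequalities -/

section Pointwise

variable {E : Type*} [NormedAddCommGroup E] [InnerProductSpace ℝ E]

/-! The number `⟨Λ_σ f, f⟩` is the minimal `σ`-energy for boundary value `f`. If `u` is `p`-harmonic
with boundary value `f`, using `u` as a competitor bounds `⟨(Λ_σ - Λ_1) f, f⟩` above by `∫ (σ -
1)|∇u|^p`. Testing the equation of `u` with the `σ`-minimizer and applying Young's inequality with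
weight `σ(x)` bounds it below by `(p-1) ∫ (1 - σ^{-1/(p-1)})|∇u|^p`. Both weights vanish exactly
where `σ = 1` and have the sign of `σ - 1` (`LInftyPlus.dnMap_sub_bounds`).

A Wolff solution is `p`-harmonic, and `τ^{-p}|∇u_τ|^p = e^{pτ(x·ρ-t)} (w² + w'²)^{p/2}`, where a
conserved quantity of the profile equation keeps `w² + w'²` between positive constants
(`IsWolffProfile.exists_bounds`). So the indicator function behaves like an exponential integral
over `D`: it decays if almost all of `D` lies in `x·ρ ≤ s` with `s < t`, and blows up, with the sign
of `σ - 1`, if a non-null part of `D` lies in `x·ρ > s` with `s > t`. For non-null `D`, the closure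
of `H_ρ` is therefore the half-space `x·ρ ≤ h_D(ρ)`, and these half-spaces intersect in the hull.

Minimizers come from uniform convexity of `|·|^p` and the Poincaré inequality. Profiles are found
explicitly in polar coordinates of the `(w, w')`-plane. -/

theorem norm_rpow_sub_two_mul_inner_self {p : ℝ} (hp : 1 < p) (a : E) :
    ‖a‖ ^ (p - 2) * inner ℝ a a = ‖a‖ ^ p := by
  rcases eq_or_ne a 0 with rfl | ha
  · simp [Real.zero_rpow (by linarith : p ≠ 0)]
  · rw [real_inner_self_eq_norm_sq, ← Real.rpow_natCast, ← Real.rpow_add (norm_pos_iff.2 ha)]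
    norm_num

/-- Cauchy–Schwarz. The case `a = 0` is separate because `p - 2` may be negative, so powers only
combine for a nonzero base. -/
theorem abs_norm_rpow_sub_two_mul_inner_le {p : ℝ} (hp : 1 < p) (a b : E) :
    |‖a‖ ^ (p - 2) * inner ℝ a b| ≤ ‖a‖ ^ (p - 1) * ‖b‖ := by
  rcases eq_or_ne a 0 with rfl | ha
  · simp [Real.zero_rpow (by linarith : p - 1 ≠ 0)]
  · have h : ‖a‖ ^ (p - 1) = ‖a‖ ^ (p - 2) * ‖a‖ := by
      rw [← Real.rpow_add_one (norm_ne_zero_iff.2 ha)]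
      ring_nf
    rw [abs_mul, abs_of_nonneg (by positivity), h, mul_assoc]
    exact mul_le_mul_of_nonneg_left (abs_real_inner_le_norm a b) (by positivity)

/-- Replace the smaller norm by the larger one. This crude form of Young's inequality supplies
integrable majorants and the absorption step in the Poincaré inequality. -/
theorem norm_rpow_sub_one_mul_le {F : Type*} [NormedAddCommGroup F] {p : ℝ} (hp : 1 < p)
    (a b : F) :
    ‖a‖ ^ (p - 1) * ‖b‖ ≤ ‖a‖ ^ p + ‖b‖ ^ p := by
  have hpow : ∀ x : ℝ, 0 ≤ x → x ^ (p - 1) * x = x ^ p := by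
    intro x hx
    rw [← Real.rpow_add_one' hx (by linarith)]
    ring_nf
  rcases le_total ‖a‖ ‖b‖ with h | h
  · calc ‖a‖ ^ (p - 1) * ‖b‖ ≤ ‖b‖ ^ (p - 1) * ‖b‖ := by gcongr
      _ = ‖b‖ ^ p := hpow _ (norm_nonneg _)
      _ ≤ _ := by linarith [Real.rpow_nonneg (norm_nonneg a) p]
  · calc ‖a‖ ^ (p - 1) * ‖b‖ ≤ ‖a‖ ^ (p - 1) * ‖a‖ := by gcongr
      _ = ‖a‖ ^ p := hpow _ (norm_nonneg _)
      _ ≤ _ := by linarith [Real.rpow_nonneg (norm_nonneg b) p]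

/-- Weighted Young inequality for `p |a|^{p-2} a · b`. -/
theorem mul_norm_rpow_mul_inner_le {p : ℝ} (hp : 1 < p) {s : ℝ} (hs : 0 < s) (a b : E) :
    p * (‖a‖ ^ (p - 2) * inner ℝ a b) ≤
      s * ‖b‖ ^ p + (p - 1) * s ^ (-1 / (p - 1)) * ‖a‖ ^ p := by
  have hp0 : 0 < p := by linarith
  have hp1 : 0 < p - 1 := by linarith
  have hpq : p.HolderConjugate (p / (p - 1)) := Real.HolderConjugate.conjExponent hp
  -- The factors `s^{1/p}` and `s^{-1/p}` cancel in the product. Raised to the conjugate exponents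
  -- they become `s` and `s^{-1/(p-1)}`.
  have h := Real.young_inequality_of_nonneg (a := s ^ (1 / p) * ‖b‖)
    (b := s ^ (-1 / p) * ‖a‖ ^ (p - 1)) (by positivity) (by positivity) hpq
  have e1 : (s ^ (1 / p) * ‖b‖) ^ p = s * ‖b‖ ^ p := by
    rw [Real.mul_rpow (by positivity) (by positivity), ← Real.rpow_mul hs.le]
    rw [one_div_mul_cancel hp0.ne', Real.rpow_one]
  have e2 : (s ^ (-1 / p) * ‖a‖ ^ (p - 1)) ^ (p / (p - 1)) = s ^ (-1 / (p - 1)) * ‖a‖ ^ p := by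
    rw [Real.mul_rpow (by positivity) (by positivity), ← Real.rpow_mul hs.le,
      ← Real.rpow_mul (norm_nonneg a)]
    congr 2 <;> field_simp
  have e3 : s ^ (1 / p) * ‖b‖ * (s ^ (-1 / p) * ‖a‖ ^ (p - 1)) = ‖a‖ ^ (p - 1) * ‖b‖ := by
    have : s ^ (1 / p) * s ^ (-1 / p) = 1 := by
      rw [← Real.rpow_add hs]
      simp [neg_div]
    linear_combination (‖a‖ ^ (p - 1) * ‖b‖) * this
  rw [e1, e2, e3] at h
  have h1 := (le_abs_self _).trans (abs_norm_rpow_sub_two_mul_inner_le hp a b)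
  calc p * (‖a‖ ^ (p - 2) * inner ℝ a b) ≤ p * (s * ‖b‖ ^ p / p +
        s ^ (-1 / (p - 1)) * ‖a‖ ^ p / (p / (p - 1))) := by
        gcongr
        exact h1.trans h
    _ = _ := by field_simp

/-- The gradient inequality for the convex function `|·|^p`. -/
theorem norm_add_rpow_sub_le {p : ℝ} (hp : 1 < p) (a b : E) :
    ‖a + b‖ ^ p - ‖a‖ ^ p ≤ p * (‖a + b‖ ^ (p - 2) * inner ℝ (a + b) b) := by
  have h := mul_norm_rpow_mul_inner_le hp one_pos (a + b) a
  have h2 := norm_rpow_sub_two_mul_inner_self hp (a + b)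
  rw [inner_add_right] at h2
  simp only [Real.one_rpow] at h
  nlinarith

/-- Only the origin is delicate, since the first factor may be singular there; the product is
bounded by `‖a‖^{p-1} ‖b‖`, which tends to zero because `p > 1`. -/
theorem continuous_norm_rpow_sub_two_mul_inner {p : ℝ} (hp : 1 < p) (b : E) :
    Continuous fun a : E => ‖a‖ ^ (p - 2) * inner ℝ a b := by
  rw [continuous_iff_continuousAt]
  intro a
  rcases eq_or_ne a 0 with rfl | ha
  · rw [ContinuousAt, inner_zero_left, mul_zero]
    refine squeeze_zero_norm (fun x => abs_norm_rpow_sub_two_mul_inner_le hp x b) ?_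
    have hc : Continuous fun x : E => ‖x‖ ^ (p - 1) * ‖b‖ :=
      (continuous_norm.rpow_const fun _ => Or.inr (by linarith)).mul continuous_const
    simpa [Real.zero_rpow (by linarith : p - 1 ≠ 0)] using hc.tendsto 0
  · exact (continuousAt_id.norm.rpow_const (Or.inl (norm_ne_zero_iff.2 ha))).mul (by fun_prop)

/-- For equal norms, strictness comes from strict convexity of the Euclidean norm; for different
norms, from strict convexity of `t ↦ t^p`. -/
theorem norm_midpoint_rpow_lt {p : ℝ} (hp : 1 < p) {a b : E} (hab : a ≠ b) :
    ‖(1 / 2 : ℝ) • (a + b)‖ ^ p < (‖a‖ ^ p + ‖b‖ ^ p) / 2 := by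
  have hp0 : 0 < p := by linarith
  have h1 : ‖(1 / 2 : ℝ) • (a + b)‖ ≤ (1 / 2) * ‖a‖ + (1 / 2) * ‖b‖ := by
    rw [norm_smul]
    have := norm_add_le a b
    norm_num
    linarith
  rcases eq_or_ne ‖a‖ ‖b‖ with h | h
  · have h2 : ‖(1 / 2 : ℝ) • (a + b)‖ < ‖b‖ := by
      have := norm_combo_lt_of_ne (a := (1 / 2 : ℝ)) (b := 1 / 2) h.le le_rfl hab (by norm_num)
        (by norm_num) (by norm_num)
      rwa [← smul_add] at this
    have h3 := Real.rpow_lt_rpow (norm_nonneg _) h2 hp0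
    rw [h]
    linarith
  · have h2 := (strictConvexOn_rpow hp).2 (norm_nonneg a) (norm_nonneg b) h
      (by norm_num : (0 : ℝ) < 1 / 2) (by norm_num : (0 : ℝ) < 1 / 2) (by norm_num)
    have h3 := Real.rpow_le_rpow (norm_nonneg _) h1 hp0.le
    simp only [smul_eq_mul] at h2
    linarith

/-- Uniform convexity of `|·|^p`. -/
theorem exists_norm_sub_rpow_le [FiniteDimensional ℝ E] {p : ℝ} (hp : 1 < p) {ε : ℝ}
    (hε : 0 < ε) :
    ∃ C : ℝ, 0 ≤ C ∧ ∀ a b : E, ‖a - b‖ ^ p ≤ ε * (‖a‖ ^ p + ‖b‖ ^ p) +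
      C * ((‖a‖ ^ p + ‖b‖ ^ p) / 2 - ‖(1 / 2 : ℝ) • (a + b)‖ ^ p) := by
  have hp0 : 0 < p := by linarith
  have hc : Continuous fun x : E => ‖x‖ ^ p := continuous_norm.rpow_const fun _ => Or.inr hp0.le
  let D : E × E → ℝ := fun z => (‖z.1‖ ^ p + ‖z.2‖ ^ p) / 2 - ‖(1 / 2 : ℝ) • (z.1 + z.2)‖ ^ p
  have hD : Continuous D :=
    (((hc.comp continuous_fst).add (hc.comp continuous_snd)).div_const 2).sub
      (hc.comp (by fun_prop : Continuous fun z : E × E => (1 / 2 : ℝ) • (z.1 + z.2)))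
  have hD0 : ∀ a b : E, 0 ≤ D (a, b) := by
    intro a b
    rcases eq_or_ne a b with rfl | h
    · have : (1 / 2 : ℝ) • (a + a) = a := by
        rw [← two_smul ℝ a, smul_smul]
        norm_num
      simp only [D, this]
      linarith
    · exact sub_nonneg.2 (norm_midpoint_rpow_lt hp h).le
  -- Normalized pairs that are not close together. This set is compact and avoids the diagonal, so
  -- the midpoint defect `D` has a positive lower bound `δ` on it. Off this set the `ε`-term alone
  -- suffices.
  let K : Set (E × E) := {z | ‖z.1‖ ^ p + ‖z.2‖ ^ p = 1 ∧ ε ≤ ‖z.1 - z.2‖ ^ p}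
  have hKc : IsClosed K := by
    refine IsClosed.inter ?_ ?_
    · exact isClosed_eq ((hc.comp continuous_fst).add (hc.comp continuous_snd)) continuous_const
    · exact isClosed_le continuous_const (hc.comp (continuous_fst.sub continuous_snd))
  have hone : ∀ x : E, ‖x‖ ^ p ≤ 1 → ‖x‖ ≤ 1 := by
    intro x hx
    by_contra! h
    exact absurd hx (not_le.2 (Real.one_lt_rpow h hp0))
  have hK : IsCompact K := by
    refine (isCompact_closedBall (0 : E × E) 1).of_isClosed_subset hKc ?_
    rintro ⟨a, b⟩ ⟨h, -⟩
    have ha := Real.rpow_nonneg (norm_nonneg a) p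
    have hb := Real.rpow_nonneg (norm_nonneg b) p
    simp only at h
    rw [mem_closedBall_zero_iff, Prod.norm_def]
    exact max_le (hone a (by linarith)) (hone b (by linarith))
  obtain ⟨δ, hδ, hδK⟩ : ∃ δ > 0, ∀ z ∈ K, δ ≤ D z := by
    rcases K.eq_empty_or_nonempty with h | h
    · exact ⟨1, one_pos, by simp [h]⟩
    · obtain ⟨z, hz, hmin⟩ := hK.exists_isMinOn h hD.continuousOn
      refine ⟨D z, sub_pos.2 (norm_midpoint_rpow_lt hp ?_), fun y hy => hmin hy⟩
      intro h
      have := hz.2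
      rw [h, sub_self, norm_zero, Real.zero_rpow hp0.ne'] at this
      linarith
  obtain ⟨M, hM⟩ : ∃ M : ℝ, ∀ a b : E, ‖a‖ ^ p + ‖b‖ ^ p = 1 → ‖a - b‖ ^ p ≤ M := by
    refine ⟨2 ^ p, fun a b h => Real.rpow_le_rpow (norm_nonneg _) ?_ hp0.le⟩
    have ha := Real.rpow_nonneg (norm_nonneg a) p
    have hb := Real.rpow_nonneg (norm_nonneg b) p
    linarith [norm_sub_le a b, hone a (by linarith), hone b (by linarith)]
  have hM0 : 0 ≤ |M| := abs_nonneg M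
  have hunit : ∀ a b : E, ‖a‖ ^ p + ‖b‖ ^ p = 1 → ‖a - b‖ ^ p ≤ ε + |M| / δ * D (a, b) := by
    intro a b h
    by_cases hε' : ε ≤ ‖a - b‖ ^ p
    · have h1 := hδK (a, b) ⟨h, hε'⟩
      have h2 : |M| / δ * δ ≤ |M| / δ * D (a, b) := by gcongr
      rw [div_mul_cancel₀ _ hδ.ne'] at h2
      linarith [hM a b h, le_abs_self M]
    · have := hD0 a b
      have : 0 ≤ |M| / δ * D (a, b) := by positivity
      linarith
  refine ⟨|M| / δ, by positivity, fun a b => ?_⟩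
  set S := ‖a‖ ^ p + ‖b‖ ^ p with hS
  have hS0 : 0 ≤ S := by positivity
  rcases hS0.eq_or_lt with h0 | h0
  · have ha : ‖a‖ ^ p = 0 := le_antisymm (by linarith [Real.rpow_nonneg (norm_nonneg b) p])
      (by positivity)
    have hb : ‖b‖ ^ p = 0 := le_antisymm (by linarith [Real.rpow_nonneg (norm_nonneg a) p])
      (by positivity)
    rw [Real.rpow_eq_zero (norm_nonneg _) hp0.ne', norm_eq_zero] at ha hb
    simp [ha, hb, S, Real.zero_rpow hp0.ne']
  -- Both sides are homogeneous of degree `p`, so scaling by `S^{-1/p}` reduces to the normalized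
  -- case.
  · have hl : ∀ x : E, ‖S ^ (-1 / p) • x‖ ^ p = S⁻¹ * ‖x‖ ^ p := by
      intro x
      rw [norm_smul, Real.norm_of_nonneg (by positivity),
        Real.mul_rpow (by positivity) (by positivity), ← Real.rpow_mul h0.le,
        div_mul_cancel₀ _ hp0.ne', Real.rpow_neg_one]
    have h1 := hunit (S ^ (-1 / p) • a) (S ^ (-1 / p) • b) (by
      rw [hl, hl, ← mul_add, ← hS, inv_mul_cancel₀ h0.ne'])
    simp only [D] at h1
    rw [← smul_sub, ← smul_add, smul_comm (1 / 2 : ℝ), hl, hl, hl, hl] at h1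
    have h2 := mul_le_mul_of_nonneg_left h1 h0.le
    have h3 : S * S⁻¹ = 1 := mul_inv_cancel₀ h0.ne'
    have e1 : S * (S⁻¹ * ‖a - b‖ ^ p) = ‖a - b‖ ^ p := by rw [← mul_assoc, h3, one_mul]
    have e2 : S * (ε + |M| / δ * ((S⁻¹ * ‖a‖ ^ p + S⁻¹ * ‖b‖ ^ p) / 2 -
        S⁻¹ * ‖(1 / 2 : ℝ) • (a + b)‖ ^ p)) = ε * S + |M| / δ * ((‖a‖ ^ p + ‖b‖ ^ p) / 2 -
        ‖(1 / 2 : ℝ) • (a + b)‖ ^ p) := by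
      linear_combination (|M| / δ * ((‖a‖ ^ p + ‖b‖ ^ p) / 2 -
        ‖(1 / 2 : ℝ) • (a + b)‖ ^ p)) * h3
    rw [e1, e2] at h2
    exact h2

end Pointwise

section

/-! ### Sobolev spaces -/

/-! ### Lebesgue spaces with a real exponent and their duality pairing. -/

section Lebesgue

variable {α E : Type*} [MeasurableSpace α] {μ : Measure α} [NormedAddCommGroup E]
  {p : ℝ} [hp : Fact (1 < p)]

theorem ofReal_ne_zero_of_fact : ENNReal.ofReal p ≠ 0 :=
  (ENNReal.ofReal_pos.2 (by linarith [hp.out])).ne'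

theorem toReal_ofReal_of_fact : (ENNReal.ofReal p).toReal = p :=
  ENNReal.toReal_ofReal (by linarith [hp.out])

theorem integrable_norm_rpow_of_memLp {f : α → E} (hf : MemLp f (ENNReal.ofReal p) μ) :
    Integrable (fun x => ‖f x‖ ^ p) μ := by
  have h := hf.integrable_norm_rpow ofReal_ne_zero_of_fact ENNReal.ofReal_ne_top
  rwa [toReal_ofReal_of_fact] at h

theorem norm_rpow_eq_integral (f : Lp E (ENNReal.ofReal p) μ) :
    ‖f‖ ^ p = ∫ x, ‖f x‖ ^ p ∂μ := by
  have h0 : 0 ≤ ∫ x, ‖f x‖ ^ p ∂μ := integral_nonneg fun x => by positivity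
  rw [Lp.norm_def, (Lp.memLp f).eLpNorm_eq_integral_rpow_norm ofReal_ne_zero_of_fact
    ENNReal.ofReal_ne_top, toReal_ofReal_of_fact (p := p), ENNReal.toReal_ofReal (by positivity),
    ← Real.rpow_mul h0, inv_mul_cancel₀ (by linarith [hp.out]), Real.rpow_one]

/-- A function in the dual Lebesgue space defines a continuous functional. -/
theorem exists_clm_integral_inner [InnerProductSpace ℝ E] {H : α → E}
    (hH : MemLp H (ENNReal.ofReal (p / (p - 1))) μ) :
    ∃ L : Lp E (ENNReal.ofReal p) μ →L[ℝ] ℝ, ∀ F, L F = ∫ x, inner ℝ (H x) (F x) ∂μ := by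
  have hpq : (p / (p - 1)).HolderConjugate p :=
    (Real.HolderConjugate.conjExponent hp.out).symm
  have := hpq.ennrealOfReal
  have : Fact (1 ≤ ENNReal.ofReal (p / (p - 1))) := ⟨ENNReal.one_le_ofReal.2 hpq.lt.le⟩
  refine ⟨(innerSL ℝ (E := E)).lpPairing μ (ENNReal.ofReal (p / (p - 1)))
    (ENNReal.ofReal p) (hH.toLp H), fun F => ?_⟩
  rw [ContinuousLinearMap.lpPairing_eq_integral]
  refine integral_congr_ae ?_
  filter_upwards [hH.coeFn_toLp] with x hx
  rw [hx, innerSL_apply_apply]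

theorem continuous_integral_inner [InnerProductSpace ℝ E] {H : α → E}
    (hH : MemLp H (ENNReal.ofReal (p / (p - 1))) μ) :
    Continuous fun F : Lp E (ENNReal.ofReal p) μ => ∫ x, inner ℝ (H x) (F x) ∂μ := by
  obtain ⟨L, hL⟩ := exists_clm_integral_inner (p := p) hH
  exact L.continuous.congr hL

end Lebesgue

variable {n : ℕ} {p : ℝ} [hp : Fact (1 < p)] {Ω : Set (Eu n)}

theorem isFiniteMeasure_restrict (hΩb : Bornology.IsBounded Ω) :
    IsFiniteMeasure (volume.restrict Ω) :=
  ⟨by simpa using hΩb.measure_lt_top⟩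

theorem memLp_of_continuous {E : Type*} [NormedAddCommGroup E] [SecondCountableTopology E]
    (hΩb : Bornology.IsBounded Ω) (hΩ : IsOpen Ω)
    {f : Eu n → E} (hf : Continuous f) (q : ENNReal) : MemLp f q (volume.restrict Ω) := by
  borelize E
  have := isFiniteMeasure_restrict hΩb
  obtain ⟨C, hC⟩ := hΩb.isCompact_closure.exists_bound_of_continuousOn hf.continuousOn
  refine MemLp.of_bound hf.aestronglyMeasurable C ?_
  filter_upwards [ae_restrict_mem hΩ.measurableSet] with x hx
  exact hC x (subset_closure hx)

/-- Each identity defining a weak gradient equates two continuous functionals, because test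
functions and their derivatives lie in the dual Lebesgue space. -/
theorem isClosed_W1p (hΩb : Bornology.IsBounded Ω) (hΩ : IsOpen Ω) :
    IsClosed (W1p p Ω : Set (Lp ℝ (ENNReal.ofReal p) (volume.restrict Ω) ×
      Lp (Eu n) (ENNReal.ofReal p) (volume.restrict Ω))) := by
  have : (W1p p Ω : Set (Lp ℝ (ENNReal.ofReal p) (volume.restrict Ω) ×
      Lp (Eu n) (ENNReal.ofReal p) (volume.restrict Ω))) =
      ⋂ (φ : Eu n → ℝ) (_ : IsTest Ω φ) (v : Eu n), {U | ∫ x in Ω, U.1 x * fderiv ℝ φ x v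
        = - ∫ x in Ω, φ x * inner ℝ (U.2 x) v} := by
    ext U
    simp only [Set.mem_iInter]
    rfl
  rw [this]
  refine isClosed_iInter fun φ => isClosed_iInter fun hφ => isClosed_iInter fun v => ?_
  refine isClosed_eq ?_ ?_
  · have hc : Continuous fun x => fderiv ℝ φ x v :=
      (hφ.1.continuous_fderiv (by simp)).clm_apply continuous_const
    have h := continuous_integral_inner (p := p)
      (memLp_of_continuous hΩb hΩ hc (ENNReal.ofReal (p / (p - 1))))
    refine (h.comp continuous_fst).congr fun U => ?_
    simp
  · have hc : Continuous fun x => φ x • v := hφ.1.continuous.smul continuous_const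
    have h := continuous_integral_inner (p := p)
      (memLp_of_continuous hΩb hΩ hc (ENNReal.ofReal (p / (p - 1))))
    refine (h.comp continuous_snd).neg.congr fun U => ?_
    simp [real_inner_smul_left, real_inner_comm]

theorem completeSpace_W1p (hΩb : Bornology.IsBounded Ω) (hΩ : IsOpen Ω) :
    CompleteSpace (W1p p Ω) :=
  (isClosed_W1p hΩb hΩ).completeSpace_coe

/-- Weak gradients are unique. -/
theorem IsWeakGrad.ae_eq (hΩ : IsOpen Ω) {u u' : Eu n → ℝ} {G G' : Eu n → Eu n}
    (h : IsWeakGrad Ω u G) (h' : IsWeakGrad Ω u' G') (hu : u =ᵐ[volume.restrict Ω] u')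
    (hG : LocallyIntegrable G (volume.restrict Ω))
    (hG' : LocallyIntegrable G' (volume.restrict Ω)) :
    G =ᵐ[volume.restrict Ω] G' := by
  have h0 := hΩ.ae_eq_zero_of_integral_contDiff_smul_eq_zero (μ := volume.restrict Ω)
    (f := G - G') ((hG.sub hG').locallyIntegrableOn _) (by
      intro φ h1 h2 h3
      have hφ : IsTest Ω φ := ⟨h1, h2, h3⟩
      have i1 := hG.integrable_smul_left_of_hasCompactSupport h1.continuous h2
      have i2 := hG'.integrable_smul_left_of_hasCompactSupport h1.continuous h2
      have hsplit : ∫ x in Ω, φ x • (G - G') x = (∫ x in Ω, φ x • G x) - ∫ x in Ω, φ x • G' x := by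
        rw [← integral_sub i1 i2]
        simp only [Pi.sub_apply, smul_sub]
      rw [hsplit, sub_eq_zero]
      refine ext_inner_left ℝ fun v => ?_
      rw [← integral_inner i1, ← integral_inner i2]
      have e : ∀ K : Eu n → Eu n, ∫ x in Ω, inner ℝ v (φ x • K x) =
          ∫ x in Ω, φ x * inner ℝ (K x) v := fun K => by
        simp only [real_inner_smul_right, real_inner_comm]
      rw [e, e]
      have := h φ hφ v
      have h2 := h' φ hφ v
      have h3 : ∫ x in Ω, u x * fderiv ℝ φ x v = ∫ x in Ω, u' x * fderiv ℝ φ x v := by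
        refine integral_congr_ae ?_
        filter_upwards [hu] with x hx
        rw [hx]
      linarith)
  filter_upwards [h0, ae_restrict_mem hΩ.measurableSet] with x hx hm
  exact sub_eq_zero.1 (hx hm)

theorem memLp_sobGrad (u : W1p p Ω) :
    MemLp (sobGrad u) (ENNReal.ofReal p) (volume.restrict Ω) :=
  Lp.memLp u.1.2

theorem integrable_norm_sobGrad_rpow (u : W1p p Ω) :
    Integrable (fun x => ‖sobGrad u x‖ ^ p) (volume.restrict Ω) :=
  integrable_norm_rpow_of_memLp (memLp_sobGrad u)

theorem locallyIntegrable_sobGrad (u : W1p p Ω) :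
    LocallyIntegrable (sobGrad u) (volume.restrict Ω) :=
  (memLp_sobGrad u).locallyIntegrable (Fact.out : 1 ≤ ENNReal.ofReal p)

theorem sobGrad_ae_eq_of_sobFn_ae_eq (hΩ : IsOpen Ω) {u v : W1p p Ω}
    (h : sobFn u =ᵐ[volume.restrict Ω] sobFn v) : sobGrad u =ᵐ[volume.restrict Ω] sobGrad v :=
  u.2.ae_eq hΩ v.2 h (locallyIntegrable_sobGrad u)
    (locallyIntegrable_sobGrad v)

theorem sobGrad_add (u v : W1p p Ω) :
    sobGrad (u + v) =ᵐ[volume.restrict Ω] fun x => sobGrad u x + sobGrad v x :=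
  Lp.coeFn_add u.1.2 v.1.2

theorem sobGrad_sub (u v : W1p p Ω) :
    sobGrad (u - v) =ᵐ[volume.restrict Ω] fun x => sobGrad u x - sobGrad v x :=
  Lp.coeFn_sub u.1.2 v.1.2

theorem sobGrad_smul (c : ℝ) (u : W1p p Ω) :
    sobGrad (c • u) =ᵐ[volume.restrict Ω] fun x => c • sobGrad u x :=
  Lp.coeFn_smul c u.1.2

/-- A continuously differentiable function has its gradient as weak gradient. -/
theorem isWeakGrad_gradient {u : Eu n → ℝ} (hu : ContDiff ℝ 1 u) :
    IsWeakGrad Ω u (gradient u) := by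
  intro φ hφ v
  have hφd : ContDiff ℝ 1 φ := hφ.1.of_le (by simp)
  have hsupp : ∀ x ∉ Ω, φ x = 0 := fun x hx =>
    image_eq_zero_of_notMem_tsupport fun h => hx (hφ.2.2 h)
  have hsupp' : ∀ x ∉ Ω, fderiv ℝ φ x v = 0 := fun x hx => by
    have : x ∉ tsupport (fderiv ℝ φ) := fun h => hx (hφ.2.2 (tsupport_fderiv_subset ℝ h))
    rw [image_eq_zero_of_notMem_tsupport this]
    rfl
  have hi : ∀ x, inner ℝ (gradient u x) v = fderiv ℝ u x v := fun x => by
    simp [gradient]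
  simp only [hi]
  rw [setIntegral_eq_integral_of_forall_compl_eq_zero (fun x hx => by rw [hsupp' x hx, mul_zero]),
    setIntegral_eq_integral_of_forall_compl_eq_zero (fun x hx => by rw [hsupp x hx, zero_mul])]
  have hcu : Continuous fun x => fderiv ℝ u x v :=
    (hu.continuous_fderiv (by simp)).clm_apply continuous_const
  have hcφ : Continuous fun x => fderiv ℝ φ x v :=
    (hφd.continuous_fderiv (by simp)).clm_apply continuous_const
  rw [integral_mul_fderiv_eq_neg_fderiv_mul_of_integrable]
  · simp only [mul_comm]
  · exact (hcu.mul hφd.continuous).integrable_of_hasCompactSupport hφ.2.1.mul_left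
  · exact (hu.continuous.mul hcφ).integrable_of_hasCompactSupport
      ((hφ.2.1.fderiv_apply ℝ v).mul_left)
  · exact (hu.continuous.mul hφd.continuous).integrable_of_hasCompactSupport hφ.2.1.mul_left
  · exact fun x _ => hu.differentiable (by simp) x
  · exact fun x _ => hφd.differentiable (by simp) x

theorem continuous_gradient {u : Eu n → ℝ} (hu : ContDiff ℝ 1 u) : Continuous (gradient u) :=
  (InnerProductSpace.toDual ℝ (Eu n)).symm.continuous.comp (hu.continuous_fderiv (by simp))

theorem norm_gradient (u : Eu n → ℝ) (x : Eu n) : ‖gradient u x‖ = ‖fderiv ℝ u x‖ := by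
  simp [gradient]

theorem exists_W1p_of_contDiff (hΩb : Bornology.IsBounded Ω) (hΩ : IsOpen Ω) (p : ℝ)
    [Fact (1 < p)] {u : Eu n → ℝ} (hu : ContDiff ℝ 1 u) :
    ∃ U : W1p p Ω, sobFn U =ᵐ[volume.restrict Ω] u ∧
      sobGrad U =ᵐ[volume.restrict Ω] gradient u := by
  have h1 := memLp_of_continuous hΩb hΩ hu.continuous (ENNReal.ofReal p)
  have h2 := memLp_of_continuous hΩb hΩ (continuous_gradient hu) (ENNReal.ofReal p)
  refine ⟨⟨(h1.toLp u, h2.toLp _), ?_⟩, h1.coeFn_toLp, h2.coeFn_toLp⟩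
  intro φ hφ v
  have h := isWeakGrad_gradient (Ω := Ω) hu φ hφ v
  have e1 : ∫ x in Ω, (h1.toLp u) x * fderiv ℝ φ x v = ∫ x in Ω, u x * fderiv ℝ φ x v := by
    refine integral_congr_ae ?_
    filter_upwards [h1.coeFn_toLp] with x hx
    rw [hx]
  have e2 : ∫ x in Ω, φ x * inner ℝ ((h2.toLp _) x) v =
      ∫ x in Ω, φ x * inner ℝ (gradient u x) v := by
    refine integral_congr_ae ?_
    filter_upwards [h2.coeFn_toLp] with x hx
    rw [hx]
  exact e1.trans (h.trans (by rw [e2]))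

theorem sobGrad_ae_eq_gradient (hΩb : Bornology.IsBounded Ω) (hΩ : IsOpen Ω) {u : W1p p Ω}
    {φ : Eu n → ℝ} (hφ : ContDiff ℝ 1 φ) (h : sobFn u =ᵐ[volume.restrict Ω] φ) :
    sobGrad u =ᵐ[volume.restrict Ω] gradient φ := by
  obtain ⟨U, h1, h2⟩ := exists_W1p_of_contDiff hΩb hΩ p hφ
  exact (sobGrad_ae_eq_of_sobFn_ae_eq hΩ (h.trans h1.symm)).trans h2

/-! ### The Poincaré inequality -/

/-- Integrate `|φ|^p` by parts against `∂_e (x·e) = 1`, use `|x·e| ≤ R` on the support, and absorb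
half of `∫ |φ|^p`. -/
theorem IsTest.integral_rpow_le {R : ℝ} (hR : 0 < R) (hΩR : Ω ⊆ Metric.closedBall 0 R)
    {e : Eu n} (he : ‖e‖ = 1) {φ : Eu n → ℝ} (hφ : IsTest Ω φ) :
    ∫ x, ‖φ x‖ ^ p ≤ (2 * p * R) ^ p * ∫ x, ‖fderiv ℝ φ x‖ ^ p := by
  have hp1 := hp.out
  have hp0 : 0 < p := by linarith
  have hφd : ContDiff ℝ 1 φ := hφ.1.of_le (by simp)
  have hg : ContDiff ℝ 1 fun x => ‖φ x‖ ^ p := hφd.norm_rpow hp1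
  have hgs : HasCompactSupport fun x => ‖φ x‖ ^ p :=
    hφ.2.1.comp_left (g := fun y : ℝ => ‖y‖ ^ p) (by simp [hp0.ne'])
  have hfd : ∀ x, fderiv ℝ (fun y : Eu n => inner ℝ y e) x e = 1 := by
    intro x
    have : HasFDerivAt (fun y : Eu n => inner ℝ e y) (innerSL ℝ e) x :=
      (innerSL ℝ e).hasFDerivAt
    simp only [real_inner_comm e]
    rw [this.fderiv, innerSL_apply_apply, real_inner_self_eq_norm_sq, he, one_pow]
  have hfc : ContDiff ℝ 1 fun y : Eu n => inner ℝ y e := contDiff_id.inner ℝ contDiff_const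
  have hcg : Continuous fun x => fderiv ℝ (fun x => ‖φ x‖ ^ p) x e :=
    (hg.continuous_fderiv (by simp)).clm_apply continuous_const
  have hint : Integrable fun x => ‖φ x‖ ^ p := hg.continuous.integrable_of_hasCompactSupport hgs
  have hint1 : Integrable fun x : Eu n => inner ℝ x e * fderiv ℝ (fun x => ‖φ x‖ ^ p) x e :=
    (hfc.continuous.mul hcg).integrable_of_hasCompactSupport
      ((hgs.fderiv_apply ℝ e).mul_left)
  have hparts := integral_mul_fderiv_eq_neg_fderiv_mul_of_integrable (μ := volume)
    (f := fun y : Eu n => inner ℝ y e) (g := fun x => ‖φ x‖ ^ p) (v := e)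
    (by simpa only [hfd, one_mul] using hint) hint1
    ((hfc.continuous.mul hg.continuous).integrable_of_hasCompactSupport hgs.mul_left)
    (fun x _ => hfc.differentiable (by simp) x) (fun x _ => hg.differentiable (by simp) x)
  simp only [hfd, one_mul] at hparts
  have hDs : HasCompactSupport fun x => ‖fderiv ℝ φ x‖ ^ p :=
    (hφ.2.1.fderiv ℝ).comp_left (g := fun y : Eu n →L[ℝ] ℝ => ‖y‖ ^ p) (by simp [hp0.ne'])
  have hDc : Continuous fun x => ‖fderiv ℝ φ x‖ ^ p :=
    (hφd.continuous_fderiv (by simp)).norm.rpow_const fun _ => Or.inr hp0.le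
  have hintD : Integrable fun x => ‖fderiv ℝ φ x‖ ^ p :=
    hDc.integrable_of_hasCompactSupport hDs
  -- With this `c`, `R p |φ|^{p-1} |∇φ|` equals half of `|φ|^{p-1} (c |∇φ|)`, so Young's inequality
  -- leaves exactly one half of `|φ|^p` to absorb.
  set c := 2 * p * R with hc
  have hc0 : 0 < c := by positivity
  have hpt : ∀ x : Eu n, -(inner ℝ x e * fderiv ℝ (fun x => ‖φ x‖ ^ p) x e) ≤
      (1 / 2) * ‖φ x‖ ^ p + (1 / 2) * (c ^ p * ‖fderiv ℝ φ x‖ ^ p) := by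
    intro x
    by_cases hx : x ∈ tsupport φ
    · have hxR : ‖x‖ ≤ R := by simpa using hΩR (hφ.2.2 hx)
      have h1 : |inner ℝ x e| ≤ R := (abs_real_inner_le_norm x e).trans (by rw [he]; linarith)
      have h2 : |fderiv ℝ (fun x => ‖φ x‖ ^ p) x e| ≤ p * ‖φ x‖ ^ (p - 1) * ‖fderiv ℝ φ x‖ := by
        have := (fderiv ℝ (fun x => ‖φ x‖ ^ p) x).le_opNorm e
        rw [he, mul_one] at this
        exact this.trans (norm_fderiv_norm_rpow_le (hφd.differentiable (by simp)) hp1)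
      have h3 := norm_rpow_sub_one_mul_le hp1 (‖φ x‖) (c * ‖fderiv ℝ φ x‖)
      rw [norm_norm, Real.norm_of_nonneg (by positivity : 0 ≤ c * ‖fderiv ℝ φ x‖),
        Real.mul_rpow hc0.le (norm_nonneg _)] at h3
      calc -(inner ℝ x e * fderiv ℝ (fun x => ‖φ x‖ ^ p) x e)
          ≤ |inner ℝ x e| * |fderiv ℝ (fun x => ‖φ x‖ ^ p) x e| := by
            rw [← abs_mul]
            exact neg_le_abs _
        _ ≤ R * (p * ‖φ x‖ ^ (p - 1) * ‖fderiv ℝ φ x‖) := by gcongr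
        _ = (1 / 2) * (‖φ x‖ ^ (p - 1) * (c * ‖fderiv ℝ φ x‖)) := by rw [hc]; ring
        _ ≤ _ := by linarith
    · have h0 : fderiv ℝ (fun x => ‖φ x‖ ^ p) x = 0 := by
        refine image_eq_zero_of_notMem_tsupport fun h => hx ?_
        refine closure_mono (fun y hy => ?_) (tsupport_fderiv_subset ℝ h)
        intro h'
        apply hy
        simp [h', hp0.ne']
      rw [h0]
      simp only [zero_apply, mul_zero, neg_zero]
      positivity
  have hle := integral_mono hint1.neg ((hint.const_mul (1 / 2)).add
    ((hintD.const_mul (c ^ p)).const_mul (1 / 2))) hpt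
  simp only [Pi.neg_apply, Pi.add_apply] at hle
  rw [integral_neg, integral_add (hint.const_mul (1 / 2))
    ((hintD.const_mul (c ^ p)).const_mul (1 / 2)), integral_const_mul, integral_const_mul,
    integral_const_mul, hparts] at hle
  linarith

/-- The Poincaré inequality on `W_0^{1,p}`. -/
theorem exists_poincare (hn : 1 ≤ n) (hΩb : Bornology.IsBounded Ω) (hΩ : IsOpen Ω) (p : ℝ)
    [hp : Fact (1 < p)] :
    ∃ C : ℝ, 0 ≤ C ∧ ∀ u ∈ W01p p Ω, ‖u.1.1‖ ≤ C * ‖u.1.2‖ := by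
  have hp0 : 0 < p := by linarith [hp.out]
  obtain ⟨R, hR, hΩR⟩ := hΩb.subset_closedBall_lt 0 0
  refine ⟨2 * p * R, by positivity, ?_⟩
  have hcl : IsClosed {u : W1p p Ω | ‖u.1.1‖ ≤ (2 * p * R) * ‖u.1.2‖} :=
    isClosed_le (by fun_prop) (by fun_prop)
  have hsub : (testSubmodule p Ω : Set (W1p p Ω)) ⊆ {u | ‖u.1.1‖ ≤ (2 * p * R) * ‖u.1.2‖} := by
    rintro u ⟨φ, hφ, hu⟩
    have hφd : ContDiff ℝ 1 φ := hφ.1.of_le (by simp)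
    have hgr := sobGrad_ae_eq_gradient hΩb hΩ hφd hu
    have h := IsTest.integral_rpow_le (p := p) hR hΩR
      (e := EuclideanSpace.single (⟨0, hn⟩ : Fin n) (1 : ℝ)) (by simp) hφ
    have e1 : ‖u.1.1‖ ^ p = ∫ x, ‖φ x‖ ^ p := by
      rw [norm_rpow_eq_integral, ← setIntegral_eq_integral_of_forall_compl_eq_zero (s := Ω)
        (f := fun x => ‖φ x‖ ^ p)]
      · refine integral_congr_ae ?_
        filter_upwards [hu] with x hx
        rw [← hx]
        rfl
      · intro x hx
        rw [image_eq_zero_of_notMem_tsupport fun h => hx (hφ.2.2 h)]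
        simp [hp0.ne']
    have e2 : ‖u.1.2‖ ^ p = ∫ x, ‖fderiv ℝ φ x‖ ^ p := by
      rw [norm_rpow_eq_integral, ← setIntegral_eq_integral_of_forall_compl_eq_zero (s := Ω)
        (f := fun x => ‖fderiv ℝ φ x‖ ^ p)]
      · refine integral_congr_ae ?_
        filter_upwards [hgr] with x hx
        rw [← norm_gradient, ← hx]
        rfl
      · intro x hx
        rw [image_eq_zero_of_notMem_tsupport fun h => hx (hφ.2.2 (tsupport_fderiv_subset ℝ h))]
        simp [hp0.ne']
    rw [← e1, ← e2, ← Real.mul_rpow (by positivity) (norm_nonneg _)] at h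
    exact (Real.rpow_le_rpow_iff (norm_nonneg _) (by positivity) hp0).1 h
  intro u hu
  exact closure_minimal hsub hcl hu

end

section

/-! ### The energy and its minimizers -/

variable {n : ℕ} {p : ℝ} [hp : Fact (1 < p)] {Ω : Set (Eu n)} {σ : Eu n → ℝ}

theorem LInftyPlus.exists_bounds (hσ : LInftyPlus Ω σ) :
    ∃ c M : ℝ, 0 < c ∧ 0 < M ∧ ∀ᵐ x ∂(volume.restrict Ω), c ≤ σ x ∧ σ x ≤ M := by
  obtain ⟨h, c, hc, hcσ⟩ := hσ
  -- The summand `1` only makes the upper bound strictly positive.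
  refine ⟨c, (eLpNorm σ ⊤ (volume.restrict Ω)).toReal + 1, hc, by positivity, ?_⟩
  have hb : ∀ᵐ x ∂(volume.restrict Ω), ‖σ x‖ₑ ≤ eLpNorm σ ⊤ (volume.restrict Ω) := by
    rw [eLpNorm_exponent_top]
    exact ae_le_eLpNormEssSup
  filter_upwards [hcσ, hb] with x h1 h2
  refine ⟨h1, ?_⟩
  have h3 := ENNReal.toReal_mono h.2.ne h2
  rw [toReal_enorm] at h3
  linarith [Real.le_norm_self (σ x)]

theorem lInftyPlus_one : LInftyPlus Ω (fun _ => 1) :=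
  ⟨memLp_top_const 1, 1, one_pos, by simp⟩

theorem integrable_mul_of_memLp_top {α : Type*} [MeasurableSpace α] {μ : Measure α} {k f : α → ℝ}
    (hk : MemLp k ⊤ μ) (hf : Integrable f μ) : Integrable (fun x => k x * f x) μ :=
  hf.smul_of_top_right hk

theorem LInftyPlus.integrable_energy (hσ : LInftyPlus Ω σ) (u : W1p p Ω) :
    Integrable (fun x => σ x * ‖sobGrad u x‖ ^ p) (volume.restrict Ω) :=
  integrable_mul_of_memLp_top hσ.1 (integrable_norm_sobGrad_rpow u)

theorem LInftyPlus.energy_nonneg (hσ : LInftyPlus Ω σ) (u : W1p p Ω) : 0 ≤ energy σ u := by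
  obtain ⟨c, M, hc, -, h⟩ := hσ.exists_bounds
  refine integral_nonneg_of_ae ?_
  filter_upwards [h] with x hx
  have : 0 ≤ σ x := by linarith
  simp only [Pi.zero_apply]
  positivity

theorem memLp_norm_rpow_sub_one {α E : Type*} [MeasurableSpace α] {μ : Measure α}
    [NormedAddCommGroup E] {G : α → E} (hG : MemLp G (ENNReal.ofReal p) μ) :
    MemLp (fun x => ‖G x‖ ^ (p - 1)) (ENNReal.ofReal (p / (p - 1))) μ := by
  have hp1 : 0 < p - 1 := by linarith [hp.out]
  have h := hG.norm_rpow_div (ENNReal.ofReal (p - 1))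
  rwa [ENNReal.toReal_ofReal hp1.le, ← ENNReal.ofReal_div_of_pos hp1] at h

theorem aestronglyMeasurable_norm_rpow_smul {α E : Type*} [MeasurableSpace α] {μ : Measure α}
    [NormedAddCommGroup E] [NormedSpace ℝ E] {G : α → E} (hG : AEStronglyMeasurable G μ) (q : ℝ) :
    AEStronglyMeasurable (fun x => ‖G x‖ ^ q • G x) μ :=
  (hG.norm.aemeasurable.pow_const q).aestronglyMeasurable.smul hG

/-- The flux is bounded by a multiple of `|∇u|^{p-1}`, whose conjugate power is `|∇u|^p`. -/
theorem LInftyPlus.memLp_flux (hσ : LInftyPlus Ω σ) (u : W1p p Ω) :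
    MemLp (fun x => σ x • ‖sobGrad u x‖ ^ (p - 2) • sobGrad u x)
      (ENNReal.ofReal (p / (p - 1))) (volume.restrict Ω) := by
  obtain ⟨c, M, hc, -, h⟩ := hσ.exists_bounds
  refine (memLp_norm_rpow_sub_one (memLp_sobGrad u)).of_le_mul (c := M)
    (hσ.1.1.smul (aestronglyMeasurable_norm_rpow_smul (memLp_sobGrad u).1 _)) ?_
  filter_upwards [h] with x hx
  have hp1 := hp.out
  have hpow : ‖sobGrad u x‖ ^ (p - 2) * ‖sobGrad u x‖ = ‖sobGrad u x‖ ^ (p - 1) := by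
    rcases eq_or_ne ‖sobGrad u x‖ 0 with h0 | h0
    · rw [h0, mul_zero, Real.zero_rpow (by linarith)]
    · rw [← Real.rpow_add_one h0]
      ring_nf
  rw [norm_smul, norm_smul, Real.norm_of_nonneg (by linarith : 0 ≤ σ x),
    Real.norm_of_nonneg (by positivity : 0 ≤ ‖sobGrad u x‖ ^ (p - 2)), hpow,
    Real.norm_of_nonneg (by positivity)]
  gcongr
  exact hx.2

/-- The functional `v ↦ ∫ σ |∇u|^{p-2} ∇u · ∇v` is continuous on `W^{1,p}`. -/
theorem LInftyPlus.exists_flux (hσ : LInftyPlus Ω σ) (u : W1p p Ω) :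
    ∃ L : W1p p Ω →L[ℝ] ℝ, ∀ v : W1p p Ω, L v =
      ∫ x in Ω, σ x * ‖sobGrad u x‖ ^ (p - 2) * inner ℝ (sobGrad u x) (sobGrad v x) := by
  obtain ⟨L, hL⟩ := exists_clm_integral_inner (p := p) (hσ.memLp_flux u)
  refine ⟨L ∘L (ContinuousLinearMap.snd ℝ _ _) ∘L (W1p p Ω).subtypeL, fun v => (hL _).trans ?_⟩
  refine integral_congr_ae (Eventually.of_forall fun x => ?_)
  simp only [real_inner_smul_left, mul_assoc]
  rfl

/-- The continuous functional `v ↦ ∫ σ |∇u|^{p-2} ∇u · ∇v`. -/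
def LInftyPlus.flux (hσ : LInftyPlus Ω σ) (u : W1p p Ω) : W1p p Ω →L[ℝ] ℝ :=
  (hσ.exists_flux u).choose

theorem LInftyPlus.flux_apply (hσ : LInftyPlus Ω σ) (u v : W1p p Ω) :
    hσ.flux u v =
      ∫ x in Ω, σ x * ‖sobGrad u x‖ ^ (p - 2) * inner ℝ (sobGrad u x) (sobGrad v x) :=
  (hσ.exists_flux u).choose_spec v

theorem LInftyPlus.integrable_flux (hσ : LInftyPlus Ω σ) (u v : W1p p Ω) :
    Integrable (fun x => σ x * (‖sobGrad u x‖ ^ (p - 2) * inner ℝ (sobGrad u x) (sobGrad v x)))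
      (volume.restrict Ω) := by
  refine integrable_mul_of_memLp_top hσ.1 ?_
  refine ((integrable_norm_sobGrad_rpow u).add (integrable_norm_sobGrad_rpow v)).mono' ?_ ?_
  · have := (aestronglyMeasurable_norm_rpow_smul (memLp_sobGrad u).1 (p - 2)).inner (𝕜 := ℝ)
      (memLp_sobGrad v).1
    simpa only [real_inner_smul_left] using this
  · exact Eventually.of_forall fun x =>
      (abs_norm_rpow_sub_two_mul_inner_le hp.out _ _).trans (norm_rpow_sub_one_mul_le hp.out _ _)

theorem LInftyPlus.flux_self (hσ : LInftyPlus Ω σ) (u : W1p p Ω) :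
    hσ.flux u u = energy σ u := by
  rw [hσ.flux_apply]
  refine integral_congr_ae (Eventually.of_forall fun x => ?_)
  simp only [mul_assoc]
  rw [norm_rpow_sub_two_mul_inner_self hp.out]

/-- The integrated gradient inequality of the convex function `|·|^p`. It replaces weak lower
semicontinuity in the existence proof and differentiation of the energy in the Euler–Lagrange
equation. -/
theorem LInftyPlus.energy_sub_le (hσ : LInftyPlus Ω σ) (u v : W1p p Ω) :
    energy σ u - energy σ v ≤ p * hσ.flux u (u - v) := by
  obtain ⟨c, M, hc, -, h⟩ := hσ.exists_bounds
  rw [hσ.flux_apply, energy, energy, ← integral_sub (hσ.integrable_energy u)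
    (hσ.integrable_energy v), ← integral_const_mul]
  simp only [mul_assoc]
  refine integral_mono_ae ((hσ.integrable_energy u).sub (hσ.integrable_energy v))
    ((hσ.integrable_flux u (u - v)).const_mul p) ?_
  filter_upwards [h, sobGrad_sub u v] with x hx hs
  have h1 := norm_add_rpow_sub_le hp.out (sobGrad v x) (sobGrad (u - v) x)
  have h2 : sobGrad v x + sobGrad (u - v) x = sobGrad u x := by
    rw [hs]
    abel
  rw [h2] at h1
  have h3 := mul_le_mul_of_nonneg_left h1 (by linarith : 0 ≤ σ x)
  linarith

theorem bdryTrace_eq_iff {u v : W1p p Ω} :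
    bdryTrace p Ω u = bdryTrace p Ω v ↔ u - v ∈ W01p p Ω :=
  Submodule.Quotient.eq _

theorem bdryTrace_half_smul_add {f : BdrySpace p Ω} {v w : W1p p Ω} (hv : bdryTrace p Ω v = f)
    (hw : bdryTrace p Ω w = f) : bdryTrace p Ω ((1 / 2 : ℝ) • (v + w)) = f := by
  have h : bdryTrace p Ω ((1 / 2 : ℝ) • (v + w)) =
      (1 / 2 : ℝ) • (bdryTrace p Ω v + bdryTrace p Ω w) := by
    simp only [bdryTrace, map_smul, map_add]
  rw [h, hv, hw, ← two_smul ℝ f, smul_smul]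
  norm_num

set_option maxHeartbeats 1000000 in
/-- Uniform convexity of the energy. -/
theorem LInftyPlus.mul_norm_sub_rpow_le (hσ : LInftyPlus Ω σ) {c ε C : ℝ}
    (hb : ∀ᵐ x ∂(volume.restrict Ω), c ≤ σ x) (hc : 0 ≤ c)
    (hC : ∀ a b : Eu n, ‖a - b‖ ^ p ≤ ε * (‖a‖ ^ p + ‖b‖ ^ p) +
      C * ((‖a‖ ^ p + ‖b‖ ^ p) / 2 - ‖(1 / 2 : ℝ) • (a + b)‖ ^ p)) (v w : W1p p Ω) :
    c * ‖(v - w).1.2‖ ^ p ≤ ε * (energy σ v + energy σ w) +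
      C * ((energy σ v + energy σ w) / 2 - energy σ ((1 / 2 : ℝ) • (v + w))) := by
  have iv := hσ.integrable_energy v
  have iw := hσ.integrable_energy w
  have iz := hσ.integrable_energy ((1 / 2 : ℝ) • (v + w))
  have i1 := (iv.add iw).const_mul ε
  have i2 := (((iv.add iw).div_const 2).sub iz).const_mul C
  rw [norm_rpow_eq_integral, ← integral_const_mul]
  have hR : ε * (energy σ v + energy σ w) +
      C * ((energy σ v + energy σ w) / 2 - energy σ ((1 / 2 : ℝ) • (v + w))) =
      ∫ x in Ω, (ε * (σ x * ‖sobGrad v x‖ ^ p + σ x * ‖sobGrad w x‖ ^ p) +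
        C * ((σ x * ‖sobGrad v x‖ ^ p + σ x * ‖sobGrad w x‖ ^ p) / 2 -
          σ x * ‖sobGrad ((1 / 2 : ℝ) • (v + w)) x‖ ^ p)) := by
    have e1 : ∫ x in Ω, (σ x * ‖sobGrad v x‖ ^ p + σ x * ‖sobGrad w x‖ ^ p) =
        energy σ v + energy σ w := integral_add iv iw
    have e2 : ∫ x in Ω, ((σ x * ‖sobGrad v x‖ ^ p + σ x * ‖sobGrad w x‖ ^ p) / 2 -
        σ x * ‖sobGrad ((1 / 2 : ℝ) • (v + w)) x‖ ^ p) =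
        (energy σ v + energy σ w) / 2 - energy σ ((1 / 2 : ℝ) • (v + w)) := by
      refine (integral_sub ((iv.add iw).div_const 2) iz).trans ?_
      simp only [Pi.add_apply]
      rw [integral_div, e1]
      rfl
    refine ((integral_add i1 i2).trans ?_).symm
    simp only [integral_const_mul, Pi.add_apply, Pi.sub_apply]
    rw [e1, e2]
  rw [hR]
  refine integral_mono_ae ((integrable_norm_sobGrad_rpow (v - w)).const_mul c) (i1.add i2) ?_
  filter_upwards [hb, sobGrad_sub v w, sobGrad_smul (1 / 2 : ℝ) (v + w), sobGrad_add v w]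
    with x hx h1 h2 h3
  have h4 := hC (sobGrad v x) (sobGrad w x)
  have e1 : (v - w).1.2 x = sobGrad v x - sobGrad w x := h1
  rw [h2, h3, e1]
  have h5 := mul_le_mul_of_nonneg_left h4 (hc.trans hx)
  have h6 : c * ‖sobGrad v x - sobGrad w x‖ ^ p ≤ σ x * ‖sobGrad v x - sobGrad w x‖ ^ p := by
    gcongr
  refine h6.trans (h5.trans (le_of_eq ?_))
  ring

set_option maxHeartbeats 1000000 in
-- No weak compactness is needed: midpoints of admissible functions are admissible, so uniform
-- convexity makes the gradients of a minimizing sequence Cauchy. Differences lie in `W01p`, where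
-- the Poincaré inequality controls the functions too.
theorem LInftyPlus.exists_isMinimizer (hn : 1 ≤ n) (hΩb : Bornology.IsBounded Ω) (hΩ : IsOpen Ω)
    (hσ : LInftyPlus Ω σ) (f : BdrySpace p Ω) : ∃ u : W1p p Ω, IsMinimizer σ f u := by
  have hp0 : 0 < p := by linarith [hp.out]
  obtain ⟨c, M, hc, -, hb⟩ := hσ.exists_bounds
  obtain ⟨K, hK0, hK⟩ := exists_poincare hn hΩb hΩ p
  obtain ⟨u₀, rfl⟩ : ∃ u₀, bdryTrace p Ω u₀ = f := (W01p p Ω).mkQ_surjective f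
  let S : Set (W1p p Ω) := {v | bdryTrace p Ω v = bdryTrace p Ω u₀}
  set m := sInf (energy σ '' S) with hm
  have hbdd : BddBelow (energy σ '' S) := ⟨0, by
    rintro _ ⟨v, -, rfl⟩
    exact hσ.energy_nonneg v⟩
  have hmle : ∀ v ∈ S, m ≤ energy σ v := fun v hv => csInf_le hbdd ⟨v, hv, rfl⟩
  have hm0 : 0 ≤ m := le_csInf ⟨_, Set.mem_image_of_mem _ (rfl : u₀ ∈ S)⟩ (by
    rintro _ ⟨v, -, rfl⟩
    exact hσ.energy_nonneg v)
  have hex : ∀ k : ℕ, ∃ v ∈ S, energy σ v < m + 1 / ((k : ℝ) + 1) := by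
    intro k
    have hlt : m < m + 1 / ((k : ℝ) + 1) := by
      have : (0 : ℝ) < 1 / ((k : ℝ) + 1) := by positivity
      linarith
    obtain ⟨_, ⟨v, hv, rfl⟩, h⟩ := exists_lt_of_csInf_lt
      ⟨_, Set.mem_image_of_mem (energy σ) (rfl : u₀ ∈ S)⟩ hlt
    exact ⟨v, hv, h⟩
  choose U hUS hU using hex
  have hmid : ∀ v ∈ S, ∀ w ∈ S, (1 / 2 : ℝ) • (v + w) ∈ S := by
    intro v hv w hw
    exact bdryTrace_half_smul_add hv hw
  have hunif : ∀ ε > 0, ∃ C ≥ 0, ∀ v ∈ S, ∀ w ∈ S, c * ‖(v - w).1.2‖ ^ p ≤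
      ε * (energy σ v + energy σ w) + C * ((energy σ v + energy σ w) / 2 - m) := by
    intro ε hε
    obtain ⟨C, hC0, hC⟩ := exists_norm_sub_rpow_le (E := Eu n) hp.out hε
    refine ⟨C, hC0, fun v hv w hw => ?_⟩
    have h1 := hσ.mul_norm_sub_rpow_le (hb.mono fun x hx => hx.1) hc.le hC v w
    have h2 := mul_le_mul_of_nonneg_left (hmle _ (hmid v hv w hw)) hC0
    linarith
  have hcauchy : CauchySeq U := by
    rw [Metric.cauchySeq_iff']
    intro η hη
    set A := max K 1 with hA
    have hA0 : 0 < A := lt_max_of_lt_right one_pos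
    set δ := c * (η / A) ^ p with hδ
    have hδ0 : 0 < δ := by positivity
    -- Energies along the sequence are at most `m + 1`, so this `ε` makes the first term at most
    -- `δ/2`. The choice `N > 2C/δ` makes the second less than `δ/2`.
    obtain ⟨C, hC0, hC⟩ := hunif (δ / (4 * (m + 1))) (by positivity)
    obtain ⟨N, hN⟩ := exists_nat_gt (2 * C / δ)
    refine ⟨N, fun k hk => ?_⟩
    have hkN : (1 : ℝ) / ((k : ℝ) + 1) ≤ 1 / ((N : ℝ) + 1) := by gcongr
    have hN1 : (1 : ℝ) / ((N : ℝ) + 1) ≤ 1 := by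
      rw [div_le_one (by positivity)]
      linarith [(Nat.cast_nonneg N : (0 : ℝ) ≤ N)]
    have h1 := hC (U k) (hUS k) (U N) (hUS N)
    have h2 := hU k
    have h3 := hU N
    have h4 : δ / (4 * (m + 1)) * (energy σ (U k) + energy σ (U N)) ≤ δ / 2 := by
      calc δ / (4 * (m + 1)) * (energy σ (U k) + energy σ (U N)) ≤
          δ / (4 * (m + 1)) * (2 * (m + 1)) := by
            gcongr
            linarith
        _ = δ / 2 := by field_simp; norm_num
    have h5 : C * ((energy σ (U k) + energy σ (U N)) / 2 - m) ≤ C * (1 / ((N : ℝ) + 1)) := by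
      gcongr
      linarith
    have h6 : C * (1 / ((N : ℝ) + 1)) < δ / 2 := by
      rw [mul_one_div, div_lt_iff₀ (by positivity)]
      rw [div_lt_iff₀ hδ0] at hN
      linarith
    have h7 : ‖(U k - U N).1.2‖ < η / A := by
      have : c * ‖(U k - U N).1.2‖ ^ p < c * (η / A) ^ p := by linarith
      exact (Real.rpow_lt_rpow_iff (norm_nonneg _) (by positivity) hp0).1
        (lt_of_mul_lt_mul_left this hc.le)
    have h8 : U k - U N ∈ W01p p Ω := bdryTrace_eq_iff.1 ((hUS k).trans (hUS N).symm)
    have h9 := hK _ h8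
    rw [dist_eq_norm]
    have h10 : ‖U k - U N‖ ≤ A * ‖(U k - U N).1.2‖ := by
      have : ‖U k - U N‖ = max ‖(U k - U N).1.1‖ ‖(U k - U N).1.2‖ := rfl
      rw [this]
      refine max_le (h9.trans ?_) ?_
      · gcongr
        exact le_max_left _ _
      · exact le_mul_of_one_le_left (norm_nonneg _) (le_max_right _ _)
    calc ‖U k - U N‖ ≤ A * ‖(U k - U N).1.2‖ := h10
      _ < A * (η / A) := by gcongr
      _ = η := by field_simp
  have := completeSpace_W1p (p := p) hΩb hΩ
  obtain ⟨u, hu⟩ := cauchySeq_tendsto_of_complete hcauchy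
  have huS : u ∈ S := by
    refine bdryTrace_eq_iff.2 ?_
    have hcl : IsClosed (W01p p Ω : Set (W1p p Ω)) := Submodule.isClosed_topologicalClosure _
    exact hcl.mem_of_tendsto (hu.sub_const u₀)
      (Eventually.of_forall fun k => bdryTrace_eq_iff.1 (hUS k))
  have hum : energy σ u ≤ m := by
    -- The flux at the limit `u` is a fixed continuous functional, so the error term tends to zero.
    have h1 : ∀ k : ℕ, energy σ u ≤ m + 1 / ((k : ℝ) + 1) + p * hσ.flux u (u - U k) := fun k => by
      linarith [hσ.energy_sub_le u (U k), hU k]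
    have h2 : Tendsto (fun k : ℕ => m + 1 / ((k : ℝ) + 1) + p * hσ.flux u (u - U k)) atTop
        (𝓝 (m + 0 + p * hσ.flux u (u - u))) :=
      (tendsto_one_div_add_atTop_nhds_zero_nat.const_add m).add
        ((((hσ.flux u).continuous.tendsto _).comp (hu.const_sub u)).const_mul p)
    have h3 := ge_of_tendsto' h2 h1
    simpa using h3
  exact ⟨u, huS, fun v hv => hum.trans (hmle v hv)⟩

/-! ### The Euler-Lagrange equation and the Dirichlet-to-Neumann map -/

/-- The gradient inequality at `u + tφ` gives the sign of the flux there for `t > 0`; dominated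
convergence lets `t → 0`. -/
theorem LInftyPlus.flux_nonneg_of_forall_energy_le (hσ : LInftyPlus Ω σ) {u φ : W1p p Ω}
    (h : ∀ t : ℝ, energy σ u ≤ energy σ (u + t • φ)) : 0 ≤ hσ.flux u φ := by
  obtain ⟨c, M, hc, hM, hb⟩ := hσ.exists_bounds
  have hp1 := hp.out
  have hpos : ∀ t : ℝ, 0 < t → 0 ≤ hσ.flux (u + t • φ) φ := by
    intro t ht
    have h1 := hσ.energy_sub_le (u + t • φ) u
    rw [add_sub_cancel_left, map_smul, smul_eq_mul] at h1
    have h2 : 0 ≤ (p * t) * hσ.flux (u + t • φ) φ := by linarith [h t]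
    exact nonneg_of_mul_nonneg_right h2 (by positivity)
  have hform : ∀ t : ℝ, hσ.flux (u + t • φ) φ = ∫ x in Ω, σ x *
      (‖sobGrad u x + t • sobGrad φ x‖ ^ (p - 2) *
        inner ℝ (sobGrad u x + t • sobGrad φ x) (sobGrad φ x)) := by
    intro t
    rw [hσ.flux_apply]
    refine integral_congr_ae ?_
    filter_upwards [sobGrad_add u (t • φ), sobGrad_smul t φ] with x h1 h2
    rw [h1, h2, mul_assoc]
  have hlim : Tendsto (fun t : ℝ => hσ.flux (u + t • φ) φ) (𝓝[>] 0) (𝓝 (hσ.flux u φ)) := by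
    have h0 := hform 0
    simp only [zero_smul, add_zero] at h0
    simp only [hform, h0]
    refine tendsto_integral_filter_of_dominated_convergence (fun x => M *
      ((‖sobGrad u x‖ + ‖sobGrad φ x‖) ^ p + ‖sobGrad φ x‖ ^ p)) ?_ ?_ ?_ ?_
    · refine Eventually.of_forall fun t => ?_
      refine hσ.1.1.mul ?_
      have hG := (memLp_sobGrad u).1.add ((memLp_sobGrad φ).1.const_smul t)
      have := (aestronglyMeasurable_norm_rpow_smul hG (p - 2)).inner (𝕜 := ℝ) (memLp_sobGrad φ).1
      simpa only [real_inner_smul_left, Pi.add_apply, Pi.smul_apply] using this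
    · have h1 : ∀ᶠ t : ℝ in 𝓝[>] 0, 0 < t := eventually_mem_nhdsWithin
      have h2 : ∀ᶠ t : ℝ in 𝓝[>] 0, t < 1 :=
        mem_nhdsWithin_of_mem_nhds (Iio_mem_nhds one_pos)
      filter_upwards [h1, h2] with t ht0 ht1
      filter_upwards [hb] with x hx
      rw [norm_mul, Real.norm_of_nonneg (by linarith : 0 ≤ σ x)]
      have h3 := (abs_norm_rpow_sub_two_mul_inner_le hp1 (sobGrad u x + t • sobGrad φ x)
        (sobGrad φ x)).trans (norm_rpow_sub_one_mul_le hp1 _ _)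
      have h4 : ‖sobGrad u x + t • sobGrad φ x‖ ≤ ‖sobGrad u x‖ + ‖sobGrad φ x‖ := by
        refine (norm_add_le _ _).trans ?_
        rw [norm_smul, Real.norm_of_nonneg ht0.le]
        have := mul_le_of_le_one_left (norm_nonneg (sobGrad φ x)) ht1.le
        linarith
      have h5 := Real.rpow_le_rpow (norm_nonneg _) h4 (by linarith : 0 ≤ p)
      exact mul_le_mul hx.2 (h3.trans (by linarith)) (norm_nonneg _) hM.le
    · have h1 : MemLp (fun x => ‖sobGrad u x‖ + ‖sobGrad φ x‖) (ENNReal.ofReal p)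
          (volume.restrict Ω) := (memLp_sobGrad u).norm.add (memLp_sobGrad φ).norm
      have h2 := integrable_norm_rpow_of_memLp h1
      refine (Integrable.add ?_ (integrable_norm_sobGrad_rpow φ)).const_mul M
      refine h2.congr (Eventually.of_forall fun x => ?_)
      simp only
      rw [Real.norm_of_nonneg (by positivity)]
    · refine Eventually.of_forall fun x => ?_
      have hc : Continuous fun t : ℝ => σ x * (‖sobGrad u x + t • sobGrad φ x‖ ^ (p - 2) *
        inner ℝ (sobGrad u x + t • sobGrad φ x) (sobGrad φ x)) :=
        continuous_const.mul ((continuous_norm_rpow_sub_two_mul_inner hp1 (sobGrad φ x)).comp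
          (by fun_prop : Continuous fun t : ℝ => sobGrad u x + t • sobGrad φ x))
      have := hc.tendsto 0
      simp only [zero_smul, add_zero] at this
      exact this.mono_left nhdsWithin_le_nhds
  refine ge_of_tendsto hlim ?_
  filter_upwards [self_mem_nhdsWithin] with t ht
  exact hpos t ht

theorem LInftyPlus.flux_eq_zero_of_isMinimizer (hσ : LInftyPlus Ω σ) {f : BdrySpace p Ω}
    {u : W1p p Ω} (hu : IsMinimizer σ f u) {φ : W1p p Ω} (hφ : φ ∈ W01p p Ω) :
    hσ.flux u φ = 0 := by
  have h : ∀ ψ ∈ W01p p Ω, 0 ≤ hσ.flux u ψ := by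
    intro ψ hψ
    refine hσ.flux_nonneg_of_forall_energy_le fun t => hu.2 _ ?_
    rw [← hu.1]
    refine bdryTrace_eq_iff.2 ?_
    rw [add_sub_cancel_left]
    exact Submodule.smul_mem _ _ hψ
  have h1 := h φ hφ
  have h2 := h (-φ) (Submodule.neg_mem _ hφ)
  rw [map_neg] at h2
  linarith

/-- By the Euler–Lagrange equation the flux of a minimizer vanishes on `W01p`, hence descends to the
quotient. -/
theorem LInftyPlus.exists_isDNValue (hn : 1 ≤ n) (hΩb : Bornology.IsBounded Ω) (hΩ : IsOpen Ω)
    (hσ : LInftyPlus Ω σ) (f : BdrySpace p Ω) :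
    ∃ ℓ : StrongDual ℝ (BdrySpace p Ω), IsDNValue σ f ℓ := by
  obtain ⟨u, hu⟩ := hσ.exists_isMinimizer hn hΩb hΩ f
  have hker : W01p p Ω ≤ LinearMap.ker (hσ.flux u : W1p p Ω →ₗ[ℝ] ℝ) := fun φ hφ =>
    hσ.flux_eq_zero_of_isMinimizer hu hφ
  refine ⟨⟨(W01p p Ω).liftQ (hσ.flux u : W1p p Ω →ₗ[ℝ] ℝ) hker, ?_⟩, u, hu, fun v => ?_⟩
  · refine (W01p p Ω).isQuotientMap_mkQ.continuous_iff.2 ?_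
    exact (hσ.flux u).continuous
  · exact hσ.flux_apply u v

/-- `⟨Λ_σ(f), f⟩` is the minimal energy. -/
theorem LInftyPlus.exists_dnMap_apply_self (hn : 1 ≤ n) (hΩb : Bornology.IsBounded Ω)
    (hΩ : IsOpen Ω) (hσ : LInftyPlus Ω σ) (f : BdrySpace p Ω) :
    ∃ u : W1p p Ω, IsMinimizer σ f u ∧ dnMap p Ω σ f f = energy σ u := by
  have h := hσ.exists_isDNValue hn hΩb hΩ f
  -- The chosen functional brings its own minimizer, so uniqueness of minimizers plays no role.
  obtain ⟨u, hu, hv⟩ := h.choose_spec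
  refine ⟨u, hu, ?_⟩
  rw [dnMap, dif_pos h]
  have := hv u
  rw [hu.1] at this
  rw [this, ← hσ.flux_apply, hσ.flux_self]

/-! ### Two-sided bounds for the difference of Dirichlet-to-Neumann maps -/

theorem LInftyPlus.rpow_memLp_top (hσ : LInftyPlus Ω σ) {q : ℝ} (hq : q ≤ 0) :
    MemLp (fun x => σ x ^ q) ⊤ (volume.restrict Ω) := by
  obtain ⟨c, M, hc, -, hb⟩ := hσ.exists_bounds
  refine memLp_top_of_bound (hσ.1.1.aemeasurable.pow_const q).aestronglyMeasurable (c ^ q) ?_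
  filter_upwards [hb] with x hx
  have h0 : 0 < σ x := by linarith
  rw [Real.norm_of_nonneg (by positivity)]
  exact Real.rpow_le_rpow_of_nonpos hc hx.1 hq

/-- If `u` is `p`-harmonic then its energy controls the energies of all functions with the same
boundary values. -/
theorem LInftyPlus.le_energy (hσ : LInftyPlus Ω σ) {u v : W1p p Ω}
    (hu : ∀ φ ∈ W01p p Ω, (lInftyPlus_one (Ω := Ω)).flux u φ = 0)
    (huv : bdryTrace p Ω v = bdryTrace p Ω u) :
    p * energy (fun _ => 1) u ≤ energy σ v +
      (p - 1) * ∫ x in Ω, σ x ^ (-1 / (p - 1)) * ‖sobGrad u x‖ ^ p := by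
  have hp1 : 0 < p - 1 := by linarith [hp.out]
  obtain ⟨c, M, hc, -, hb⟩ := hσ.exists_bounds
  have hflux : (lInftyPlus_one (Ω := Ω)).flux u v = energy (fun _ => 1) u := by
    have h1 := hu _ (bdryTrace_eq_iff.1 huv)
    rw [map_sub, LInftyPlus.flux_self] at h1
    linarith
  have hi : Integrable (fun x => σ x ^ (-1 / (p - 1)) * ‖sobGrad u x‖ ^ p) (volume.restrict Ω) :=
    integrable_mul_of_memLp_top
      (hσ.rpow_memLp_top (div_nonpos_of_nonpos_of_nonneg (by norm_num) hp1.le))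
      (integrable_norm_sobGrad_rpow u)
  rw [← hflux, LInftyPlus.flux_apply, energy, ← integral_const_mul, ← integral_const_mul,
    ← integral_add (hσ.integrable_energy v) (hi.const_mul _)]
  simp only [mul_assoc]
  refine integral_mono_ae ((lInftyPlus_one.integrable_flux u v).const_mul p)
    ((hσ.integrable_energy v).add (hi.const_mul _)) ?_
  filter_upwards [hb] with x hx
  -- Young's inequality is applied pointwise with weight `s = σ x`, which makes the `v`-term the
  -- `σ`-energy density.
  have := mul_norm_rpow_mul_inner_le hp.out (by linarith : 0 < σ x) (sobGrad u x) (sobGrad v x)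
  rw [one_mul]
  linarith

set_option maxHeartbeats 1000000 in
-- Both pairings are minimal energies. The upper bound uses `u` as a competitor for `σ`; the lower
-- bound is `LInftyPlus.le_energy` at the `σ`-minimizer.
theorem LInftyPlus.dnMap_sub_bounds (hn : 1 ≤ n) (hΩb : Bornology.IsBounded Ω) (hΩ : IsOpen Ω)
    (hσ : LInftyPlus Ω σ) {u : W1p p Ω}
    (hu : ∀ φ ∈ W01p p Ω, (lInftyPlus_one (Ω := Ω)).flux u φ = 0) :
    (p - 1) * ∫ x in Ω, (1 - σ x ^ (-1 / (p - 1))) * ‖sobGrad u x‖ ^ p ≤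
      (dnMap p Ω σ (bdryTrace p Ω u) - dnMap p Ω (fun _ => 1) (bdryTrace p Ω u))
        (bdryTrace p Ω u) ∧
    (dnMap p Ω σ (bdryTrace p Ω u) - dnMap p Ω (fun _ => 1) (bdryTrace p Ω u))
      (bdryTrace p Ω u) ≤ ∫ x in Ω, (σ x - 1) * ‖sobGrad u x‖ ^ p := by
  have hp1 : 0 < p - 1 := by linarith [hp.out]
  have hone : LInftyPlus Ω (fun _ => (1 : ℝ)) := lInftyPlus_one
  obtain ⟨v, hv, hve⟩ := hσ.exists_dnMap_apply_self hn hΩb hΩ (bdryTrace p Ω u)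
  obtain ⟨v', hv', hve'⟩ := hone.exists_dnMap_apply_self hn hΩb hΩ (bdryTrace p Ω u)
  have hi : Integrable (fun x => σ x ^ (-1 / (p - 1)) * ‖sobGrad u x‖ ^ p) (volume.restrict Ω) :=
    integrable_mul_of_memLp_top
      (hσ.rpow_memLp_top (div_nonpos_of_nonpos_of_nonneg (by norm_num) hp1.le))
      (integrable_norm_sobGrad_rpow u)
  have hi1 := integrable_norm_sobGrad_rpow u
  have he1 : energy (fun _ => 1) u = ∫ x in Ω, ‖sobGrad u x‖ ^ p := by simp [energy]
  -- For `σ = 1`, `LInftyPlus.le_energy` says that the weak solution `u` itself minimizes.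
  have h1 : energy (fun _ => 1) v' = energy (fun _ => 1) u := by
    refine le_antisymm (hv'.2 u rfl) ?_
    have := hone.le_energy hu hv'.1
    simp only [Real.one_rpow, one_mul] at this
    rw [← he1] at this
    linarith
  have key : (dnMap p Ω σ (bdryTrace p Ω u) - dnMap p Ω (fun _ => 1) (bdryTrace p Ω u))
      (bdryTrace p Ω u) = energy σ v - energy (fun _ => 1) u := by
    rw [← h1, ← hve, ← hve']
    rfl
  rw [key]
  constructor
  · have h2 := hσ.le_energy hu hv.1
    simp only [sub_mul, one_mul]
    rw [integral_sub hi1 hi, ← he1]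
    linarith
  · have h2 := hv.2 u rfl
    simp only [sub_mul, one_mul]
    rw [integral_sub (hσ.integrable_energy u) hi1, ← he1]
    simp only [energy] at h2 ⊢
    linarith

end

/-! ### Wolff profiles: existence -/

section Profile

variable {p : ℝ}

theorem sub_one_mul_sq_add_sq_pos (hp : 1 < p) {a b : ℝ} (h : 0 < a ^ 2 + b ^ 2) :
    0 < (p - 1) * b ^ 2 + a ^ 2 := by
  rcases eq_or_ne b 0 with rfl | hb
  · simpa using h
  · have : 0 < b ^ 2 := by positivity
    have : 0 < (p - 1) * b ^ 2 := mul_pos (by linarith) this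
    positivity

/-- The angle function of the Wolff profiles moves along this function with constant speed. -/
def wolffPhase (p θ : ℝ) : ℝ := p / 2 * θ - (p - 2) / 2 * (Real.sin θ * Real.cos θ)

theorem hasDerivAt_wolffPhase (p θ : ℝ) :
    HasDerivAt (wolffPhase p) ((p - 1) * Real.sin θ ^ 2 + Real.cos θ ^ 2) θ := by
  have h := ((hasDerivAt_id θ).const_mul (p / 2)).sub
    (((Real.hasDerivAt_sin θ).mul (Real.hasDerivAt_cos θ)).const_mul ((p - 2) / 2))
  refine h.congr_deriv ?_
  linear_combination (-(p / 2)) * Real.sin_sq_add_cos_sq θ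

theorem contDiff_wolffPhase (p : ℝ) : ContDiff ℝ ∞ (wolffPhase p) := by
  have h1 : ContDiff ℝ ∞ Real.sin := Real.contDiff_sin
  have h2 : ContDiff ℝ ∞ Real.cos := Real.contDiff_cos
  exact (contDiff_const.mul contDiff_id).sub (contDiff_const.mul (h1.mul h2))

theorem deriv_wolffPhase_pos (hp : 1 < p) (θ : ℝ) :
    0 < (p - 1) * Real.sin θ ^ 2 + Real.cos θ ^ 2 :=
  sub_one_mul_sq_add_sq_pos hp (by rw [Real.cos_sq_add_sin_sq]; exact one_pos)

theorem abs_wolffPhase_sub_le (p θ : ℝ) : |wolffPhase p θ - p / 2 * θ| ≤ |(p - 2) / 2| := by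
  rw [wolffPhase, sub_sub_cancel_left, abs_neg, abs_mul, abs_mul]
  have := mul_le_mul (Real.abs_sin_le_one θ) (Real.abs_cos_le_one θ) (abs_nonneg _) zero_le_one
  exact mul_le_of_le_one_right (abs_nonneg _) (by linarith)

/-- The phase has positive derivative and stays within bounded distance of the linear function
`pθ/2`, so it is strictly increasing and onto. -/
theorem exists_homeomorph_wolffPhase (hp : 1 < p) :
    ∃ f : ℝ ≃ₜ ℝ, ∀ θ, f θ = wolffPhase p θ := by
  have hmono : StrictMono (wolffPhase p) := strictMono_of_deriv_pos fun θ => by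
    rw [(hasDerivAt_wolffPhase p θ).deriv]
    exact deriv_wolffPhase_pos hp θ
  have hsurj : Function.Surjective (wolffPhase p) := by
    refine (contDiff_wolffPhase p).continuous.surjective ?_ ?_
    · refine tendsto_atTop_mono (f := fun θ => p / 2 * θ - |(p - 2) / 2|) (fun θ => ?_) ?_
      · linarith [(abs_le.1 (abs_wolffPhase_sub_le p θ)).1]
      · exact tendsto_atTop_add_const_right _ _
          (tendsto_id.const_mul_atTop (by linarith : 0 < p / 2))
    · refine tendsto_atBot_mono (g := wolffPhase p) (f := fun θ => p / 2 * θ + |(p - 2) / 2|) (fun θ => ?_) ?_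
      · linarith [(abs_le.1 (abs_wolffPhase_sub_le p θ)).2]
      · exact tendsto_atBot_add_const_right _ _
          (tendsto_id.const_mul_atBot (by linarith : 0 < p / 2))
  exact ⟨(hmono.orderIsoOfSurjective _ hsurj).toHomeomorph, fun θ => rfl⟩

/-- Separation of variables: the phase of `θ(s)` must be affine in `s` with slope `-(p-1)`.
Inverting the phase gives a smooth solution on all of `ℝ` at once. -/
theorem exists_wolffAngle (hp : 1 < p) (θ₀ : ℝ) :
    ∃ θ : ℝ → ℝ, ContDiff ℝ ∞ θ ∧ θ 0 = θ₀ ∧ ∀ s, HasDerivAt θ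
      (-(p - 1) / ((p - 1) * Real.sin (θ s) ^ 2 + Real.cos (θ s) ^ 2)) s := by
  obtain ⟨f, hf⟩ := exists_homeomorph_wolffPhase hp
  have hfe : (f : ℝ → ℝ) = wolffPhase p := funext hf
  have hsymm : ContDiff ℝ ∞ f.symm := by
    refine f.contDiff_symm_deriv (fun θ => (deriv_wolffPhase_pos hp θ).ne') (fun θ => ?_) ?_
    · rw [hfe]
      exact hasDerivAt_wolffPhase p θ
    · rw [hfe]
      exact contDiff_wolffPhase p
  have hθ : ContDiff ℝ ∞ fun s : ℝ => f.symm (f θ₀ - (p - 1) * s) :=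
    hsymm.comp (contDiff_const.sub (contDiff_const.mul contDiff_id))
  refine ⟨_, hθ, by simp, fun s => ?_⟩
  set θ : ℝ → ℝ := fun s => f.symm (f θ₀ - (p - 1) * s) with hθdef
  have hd : HasDerivAt θ (deriv θ s) s := (hθ.differentiable (by simp) s).hasDerivAt
  have h1 := (hasDerivAt_wolffPhase p (θ s)).comp s hd
  have h2 : wolffPhase p ∘ θ = fun s => f θ₀ - (p - 1) * s := by
    funext s
    rw [Function.comp_apply, ← hf, hθdef]
    simp
  rw [h2] at h1
  have h3 := ((hasDerivAt_id s).const_mul (p - 1)).const_sub (f θ₀)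
  have h4 := h1.unique h3
  refine hd.congr_deriv ?_
  rw [eq_div_iff (deriv_wolffPhase_pos hp (θ s)).ne']
  linarith

theorem exists_polar {a b : ℝ} (h : (a, b) ≠ (0, 0)) :
    ∃ r θ : ℝ, 0 < r ∧ a = r * Real.cos θ ∧ b = r * Real.sin θ := by
  have hz : (⟨a, b⟩ : ℂ) ≠ 0 := fun h0 => h (by
    rw [Complex.ext_iff] at h0
    exact Prod.ext h0.1 h0.2)
  refine ⟨‖(⟨a, b⟩ : ℂ)‖, Complex.arg ⟨a, b⟩, norm_pos_iff.2 hz, ?_, ?_⟩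
  · rw [Complex.norm_mul_cos_arg]
  · rw [Complex.norm_mul_sin_arg]

/-- Write `(w, w') = A (cos θ, sin θ)`. The angle then satisfies an autonomous equation, and the
amplitude is an explicit function of the angle. -/
theorem exists_isWolffProfile (hp : 1 < p) {a₀ b₀ : ℝ} (hab : (a₀, b₀) ≠ (0, 0)) :
    ∃ w : ℝ → ℝ, IsWolffProfile p a₀ b₀ w := by
  obtain ⟨r, θ₀, hr, ha, hb⟩ := exists_polar hab
  obtain ⟨θ, hθ, hθ0, hθd⟩ := exists_wolffAngle hp θ₀
  have hp1 : p - 1 ≠ 0 := by linarith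
  set k := (p - 2) / (p - 1) with hk
  -- The requirement `(A cos θ)' = A sin θ` amounts to `A'/A = k sin θ cos θ θ'`, which integrates
  -- to this formula with `A = r` at `θ₀`.
  set A : ℝ → ℝ := fun s => r * Real.exp (k / 2 * (Real.sin (θ s) ^ 2 - Real.sin θ₀ ^ 2)) with hA
  have hApos : ∀ s, 0 < A s := fun s => by positivity
  set T : ℝ → ℝ := fun s => -(p - 1) / ((p - 1) * Real.sin (θ s) ^ 2 + Real.cos (θ s) ^ 2) with hT
  have hAd : ∀ s, HasDerivAt A (A s * (k * Real.sin (θ s) * Real.cos (θ s) * T s)) s := by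
    intro s
    have h := (((((hθd s).sin.pow 2).sub_const (Real.sin θ₀ ^ 2)).const_mul (k / 2)).exp).const_mul r
    refine h.congr_deriv ?_
    simp only [hA, hT, Pi.pow_apply]
    push_cast
    ring
  have hwd : ∀ s, HasDerivAt (fun s => A s * Real.cos (θ s)) (A s * Real.sin (θ s)) s := by
    intro s
    refine ((hAd s).mul (hθd s).cos).congr_deriv ?_
    have hden := (deriv_wolffPhase_pos hp (θ s)).ne'
    have hcs : Real.cos (θ s) ^ 2 = 1 - Real.sin (θ s) ^ 2 := by
      linarith [Real.sin_sq_add_cos_sq (θ s)]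
    simp only [hT, hk]
    field_simp
    rw [hcs]
    ring
  have hvd : ∀ s, HasDerivAt (fun s => A s * Real.sin (θ s))
      (-(wolffV p (A s * Real.cos (θ s)) (A s * Real.sin (θ s)) * (A s * Real.cos (θ s)))) s := by
    intro s
    refine ((hAd s).mul (hθd s).sin).congr_deriv ?_
    have hden := (deriv_wolffPhase_pos hp (θ s)).ne'
    have hA0 := (hApos s).ne'
    have hV : wolffV p (A s * Real.cos (θ s)) (A s * Real.sin (θ s)) =
        ((2 * p - 3) * Real.sin (θ s) ^ 2 + (p - 1) * Real.cos (θ s) ^ 2) /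
          ((p - 1) * Real.sin (θ s) ^ 2 + Real.cos (θ s) ^ 2) := by
      have e1 : (2 * p - 3) * (A s * Real.sin (θ s)) ^ 2 + (p - 1) * (A s * Real.cos (θ s)) ^ 2 =
        A s ^ 2 * ((2 * p - 3) * Real.sin (θ s) ^ 2 + (p - 1) * Real.cos (θ s) ^ 2) := by ring
      have e2 : (p - 1) * (A s * Real.sin (θ s)) ^ 2 + (A s * Real.cos (θ s)) ^ 2 =
        A s ^ 2 * ((p - 1) * Real.sin (θ s) ^ 2 + Real.cos (θ s) ^ 2) := by ring
      rw [wolffV, e1, e2, mul_div_mul_left _ _ (pow_ne_zero 2 hA0)]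
    have hcs : Real.cos (θ s) ^ 2 = 1 - Real.sin (θ s) ^ 2 := by
      linarith [Real.sin_sq_add_cos_sq (θ s)]
    rw [hV]
    simp only [hT, hk]
    rw [hcs] at hden ⊢
    field_simp
    ring
  have hw' : deriv (fun s => A s * Real.cos (θ s)) = fun s => A s * Real.sin (θ s) :=
    funext fun s => (hwd s).deriv
  have hAc : ContDiff ℝ ∞ A :=
    contDiff_const.mul ((contDiff_const.mul ((hθ.sin.pow 2).sub contDiff_const)).exp)
  have hA0 : A 0 = r := by simp [hA, hθ0]
  refine ⟨fun s => A s * Real.cos (θ s), hAc.mul hθ.cos, fun s => ?_, ?_, ?_⟩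
  · rw [hw', (hvd s).deriv]
    ring
  · simp only [hA0, hθ0, ha]
  · rw [hw']
    simp only [hA0, hθ0, hb]

/-! ### Wolff profiles: bounds -/

variable {a₀ b₀ : ℝ} {w : ℝ → ℝ}

theorem one_sub_wolffV {a b : ℝ} (h : (p - 1) * b ^ 2 + a ^ 2 ≠ 0) :
    1 - wolffV p a b = (2 - p) * (a ^ 2 + b ^ 2) / ((p - 1) * b ^ 2 + a ^ 2) := by
  rw [wolffV, eq_div_iff h, sub_mul, div_mul_cancel₀ _ h]
  ring

/-- The denominator of `wolffV` is at least `min (p-1) 1` times `a² + b²`. The bound feeds a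
Grönwall argument; at the origin, where `wolffV` is a division by zero, the factor `a` saves it. -/
theorem exists_abs_mul_one_sub_wolffV_le (hp : 1 < p) :
    ∃ K : ℝ, ∀ a b : ℝ, |2 * a * b * (1 - wolffV p a b)| ≤ K * (a ^ 2 + b ^ 2) := by
  set d := min (p - 1) 1 with hd
  have hd0 : 0 < d := lt_min (by linarith) one_pos
  refine ⟨|2 - p| / d, fun a b => ?_⟩
  rcases (by positivity : 0 ≤ a ^ 2 + b ^ 2).eq_or_lt with h | h
  · have ha : a = 0 := by nlinarith
    simp [ha]
    positivity
  · have hden := sub_one_mul_sq_add_sq_pos hp h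
    have hle : d * (a ^ 2 + b ^ 2) ≤ (p - 1) * b ^ 2 + a ^ 2 := by
      nlinarith [min_le_left (p - 1) 1, min_le_right (p - 1) 1, sq_nonneg a, sq_nonneg b]
    have h1 : |1 - wolffV p a b| ≤ |2 - p| / d := by
      rw [one_sub_wolffV hden.ne', abs_div, abs_mul, abs_of_pos h, abs_of_pos hden,
        div_le_div_iff₀ hden hd0]
      nlinarith [abs_nonneg (2 - p)]
    have h2 : |2 * a * b| ≤ a ^ 2 + b ^ 2 := by
      rw [abs_le]
      constructor <;> nlinarith [sq_nonneg (a + b), sq_nonneg (a - b)]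
    rw [abs_mul, mul_comm]
    exact mul_le_mul h1 h2 (abs_nonneg _) (by positivity)

theorem IsWolffProfile.hasDerivAt (h : IsWolffProfile p a₀ b₀ w) (s : ℝ) :
    HasDerivAt w (deriv w s) s :=
  (h.1.differentiable (by simp) s).hasDerivAt

theorem IsWolffProfile.contDiff_deriv (h : IsWolffProfile p a₀ b₀ w) : ContDiff ℝ ∞ (deriv w) :=
  ((contDiff_infty_iff_deriv (f := w)).1 h.1).2

theorem IsWolffProfile.hasDerivAt_deriv (h : IsWolffProfile p a₀ b₀ w) (s : ℝ) :
    HasDerivAt (deriv w) (-(wolffV p (w s) (deriv w s) * w s)) s := by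
  refine (h.contDiff_deriv.differentiable (by simp) s).hasDerivAt.congr_deriv ?_
  linarith [h.2.1 s]

theorem IsWolffProfile.hasDerivAt_sq_add_sq (h : IsWolffProfile p a₀ b₀ w) (s : ℝ) :
    HasDerivAt (fun s => w s ^ 2 + deriv w s ^ 2)
      (2 * w s * deriv w s * (1 - wolffV p (w s) (deriv w s))) s := by
  refine (((h.hasDerivAt s).pow 2).add ((h.hasDerivAt_deriv s).pow 2)).congr_deriv ?_
  push_cast
  ring

/-- Grönwall: `F = w² + w'²` satisfies `|F'| ≤ K F`, so `F e^{Ks}` is nondecreasing and `F e^{-Ks}`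
nonincreasing. Positivity at `0` spreads in both directions. -/
theorem IsWolffProfile.sq_add_sq_pos (hp : 1 < p) (hab : (a₀, b₀) ≠ (0, 0))
    (h : IsWolffProfile p a₀ b₀ w) (s : ℝ) : 0 < w s ^ 2 + deriv w s ^ 2 := by
  obtain ⟨K, hK⟩ := exists_abs_mul_one_sub_wolffV_le hp
  set F : ℝ → ℝ := fun s => w s ^ 2 + deriv w s ^ 2 with hF
  have h0 : 0 < F 0 := by
    simp only [hF, h.2.2.1, h.2.2.2]
    by_contra! hle
    refine hab (Prod.ext ?_ ?_)
    · show a₀ = 0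
      nlinarith [sq_nonneg a₀, sq_nonneg b₀]
    · show b₀ = 0
      nlinarith [sq_nonneg a₀, sq_nonneg b₀]
  have hexp : ∀ c s : ℝ, HasDerivAt (fun s => F s * Real.exp (c * s))
      ((2 * w s * deriv w s * (1 - wolffV p (w s) (deriv w s)) + c * F s) * Real.exp (c * s)) s := by
    intro c s
    refine ((h.hasDerivAt_sq_add_sq s).mul ((hasDerivAt_id s).const_mul c).exp).congr_deriv ?_
    simp only [hF, id]
    ring
  have hbound : ∀ s, |2 * w s * deriv w s * (1 - wolffV p (w s) (deriv w s))| ≤ K * F s :=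
    fun s => hK _ _
  rcases le_total 0 s with hs | hs
  · have hm : Monotone fun s => F s * Real.exp (K * s) :=
      monotone_of_deriv_nonneg (fun s => (hexp K s).differentiableAt) fun s => by
        rw [(hexp K s).deriv]
        have := (abs_le.1 (hbound s)).1
        exact mul_nonneg (by linarith) (Real.exp_pos _).le
    have h1 := hm hs
    simp only [mul_zero, Real.exp_zero, mul_one] at h1
    exact pos_of_mul_pos_left (h0.trans_le h1) (Real.exp_pos _).le
  · have hm : Antitone fun s => F s * Real.exp (-K * s) :=
      antitone_of_deriv_nonpos (fun s => (hexp (-K) s).differentiableAt) fun s => by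
        rw [(hexp (-K) s).deriv]
        have := (abs_le.1 (hbound s)).2
        exact mul_nonpos_of_nonpos_of_nonneg (by linarith) (Real.exp_pos _).le
    have h1 := hm hs
    simp only [mul_zero, Real.exp_zero, mul_one] at h1
    exact pos_of_mul_pos_left (h0.trans_le h1) (Real.exp_pos _).le

/-- A conserved quantity bounds `w² + w'²` from both sides. -/
theorem IsWolffProfile.exists_bounds (hp : 1 < p) (hab : (a₀, b₀) ≠ (0, 0))
    (h : IsWolffProfile p a₀ b₀ w) :
    ∃ m M : ℝ, 0 < m ∧ ∀ s, m ≤ w s ^ 2 + deriv w s ^ 2 ∧ w s ^ 2 + deriv w s ^ 2 ≤ M := by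
  have hp1 : p - 1 ≠ 0 := by linarith
  set k := (p - 2) / (p - 1) with hk
  set F : ℝ → ℝ := fun s => w s ^ 2 + deriv w s ^ 2 with hF
  have hFpos : ∀ s, 0 < F s := h.sq_add_sq_pos hp hab
  -- In polar coordinates this is `A² exp(-k sin² θ)`, constant by the amplitude formula. Since
  -- `w'²/F` lies in `[0, 1]`, the exponent is bounded by `|k|`.
  set Q : ℝ → ℝ := fun s => F s * Real.exp (-k * (deriv w s ^ 2 / F s)) with hQ
  have hQd : ∀ s, HasDerivAt Q 0 s := by
    intro s
    have hden := (sub_one_mul_sq_add_sq_pos hp (hFpos s)).ne'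
    have hF0 : w s ^ 2 + deriv w s ^ 2 ≠ 0 := (hFpos s).ne'
    have hFd := h.hasDerivAt_sq_add_sq s
    have h1 := ((h.hasDerivAt_deriv s).pow 2).div hFd hF0
    have h2 := hFd.mul (h1.const_mul (-k)).exp
    refine h2.congr_deriv ?_
    rw [one_sub_wolffV hden, wolffV, hk]
    simp only [Pi.pow_apply]
    push_cast
    generalize w s = a at *
    generalize deriv w s = b at *
    generalize Real.exp _ = X
    field_simp
    ring
  have hconst : ∀ s, Q s = Q 0 := fun s =>
    is_const_of_deriv_eq_zero (fun s => (hQd s).differentiableAt) (fun s => (hQd s).deriv) s 0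
  have hQ0 : 0 < Q 0 := mul_pos (hFpos 0) (Real.exp_pos _)
  have hFQ : ∀ s, F s = Q 0 * Real.exp (k * (deriv w s ^ 2 / F s)) := by
    intro s
    rw [← hconst s, hQ]
    simp only
    rw [mul_assoc, ← Real.exp_add]
    simp
  have habs : ∀ s, |k * (deriv w s ^ 2 / F s)| ≤ |k| := by
    intro s
    rw [abs_mul]
    refine mul_le_of_le_one_right (abs_nonneg _) ?_
    have := hFpos s
    rw [abs_of_nonneg (by positivity), div_le_one this]
    simp only [hF]
    linarith [sq_nonneg (w s)]
  refine ⟨Q 0 * Real.exp (-|k|), Q 0 * Real.exp |k|, by positivity, fun s => ?_⟩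
  have h1 := abs_le.1 (habs s)
  change _ ≤ F s ∧ F s ≤ _
  rw [hFQ s]
  constructor <;> gcongr
  · exact h1.1
  · exact h1.2

/-- The divergence form of the profile equation; this is what remains of the `p`-Laplace equation
after separating the exponential. -/
theorem IsWolffProfile.hasDerivAt_flux (hp : 1 < p) (hab : (a₀, b₀) ≠ (0, 0))
    (h : IsWolffProfile p a₀ b₀ w) (s : ℝ) :
    HasDerivAt (fun s => (w s ^ 2 + deriv w s ^ 2) ^ ((p - 2) / 2) * deriv w s)
      (-(p - 1) * ((w s ^ 2 + deriv w s ^ 2) ^ ((p - 2) / 2) * w s)) s := by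
  have hpos := h.sq_add_sq_pos hp hab s
  have hden := (sub_one_mul_sq_add_sq_pos hp hpos).ne'
  have h1 := ((h.hasDerivAt_sq_add_sq s).rpow_const (p := (p - 2) / 2) (Or.inl hpos.ne')).mul
    (h.hasDerivAt_deriv s)
  refine h1.congr_deriv ?_
  have hpow : (w s ^ 2 + deriv w s ^ 2) ^ ((p - 2) / 2) =
      (w s ^ 2 + deriv w s ^ 2) ^ ((p - 2) / 2 - 1) * (w s ^ 2 + deriv w s ^ 2) := by
    rw [← Real.rpow_add_one hpos.ne']
    ring_nf
  rw [hpow, one_sub_wolffV hden, wolffV]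
  generalize w s = a at *
  generalize deriv w s = b at *
  generalize (a ^ 2 + b ^ 2) ^ ((p - 2) / 2 - 1) = X
  generalize hD : (p - 1) * b ^ 2 + a ^ 2 = D at *
  field_simp
  rw [← hD]
  ring

end Profile

section

/-! ### Wolff solutions are `p`-harmonic -/

variable {n : ℕ} {p : ℝ} {Ω : Set (Eu n)} {σ : Eu n → ℝ} {w : ℝ → ℝ} {a₀ b₀ : ℝ}

/-- The rates `c` and `τ` are independent because the solution has `c = τ` while its flux has `c =
(p-1)τ`. -/
theorem hasFDerivAt_exp_mul_comp {ρ ρ' : Eu n} {c t τ : ℝ} {h : ℝ → ℝ} {h' : ℝ} {x : Eu n}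
    (hh : HasDerivAt h h' (τ * inner ℝ x ρ')) :
    HasFDerivAt (fun y : Eu n => Real.exp (c * (inner ℝ y ρ - t)) * h (τ * inner ℝ y ρ'))
      (Real.exp (c * (inner ℝ x ρ - t)) • ((c * h (τ * inner ℝ x ρ')) • innerSL ℝ ρ +
        (τ * h') • innerSL ℝ ρ')) x := by
  have hin : ∀ v : Eu n, HasFDerivAt (fun y : Eu n => inner ℝ y v) (innerSL ℝ v) x := by
    intro v
    simp only [real_inner_comm v]
    exact (innerSL ℝ v).hasFDerivAt
  have h1 := (((hin ρ).sub_const t).const_mul c).exp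
  have h2 := hh.comp_hasFDerivAt x ((hin ρ').const_mul τ)
  refine (h1.mul h2).congr_fderiv ?_
  ext v
  simp
  ring

theorem contDiff_exp_mul_comp {ρ ρ' : Eu n} {c t τ : ℝ} {h : ℝ → ℝ} {k : WithTop ℕ∞}
    (hh : ContDiff ℝ k h) :
    ContDiff ℝ k (fun y : Eu n => Real.exp (c * (inner ℝ y ρ - t)) * h (τ * inner ℝ y ρ')) := by
  have hin : ∀ v : Eu n, ContDiff ℝ k fun y : Eu n => inner ℝ y v := fun v =>
    contDiff_id.inner ℝ contDiff_const
  exact ((contDiff_const.mul ((hin ρ).sub contDiff_const)).exp).mul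
    (hh.comp (contDiff_const.mul (hin ρ')))

theorem IsWolffProfile.contDiff_wolffSol (h : IsWolffProfile p a₀ b₀ w) (ρ ρ' : Eu n) (t τ : ℝ) :
    ContDiff ℝ ∞ (wolffSol w ρ ρ' t τ) :=
  contDiff_exp_mul_comp h.1

theorem IsWolffProfile.gradient_wolffSol (h : IsWolffProfile p a₀ b₀ w) (ρ ρ' : Eu n) (t τ : ℝ)
    (x : Eu n) : gradient (wolffSol w ρ ρ' t τ) x = (τ * Real.exp (τ * (inner ℝ x ρ - t))) •
      (w (τ * inner ℝ x ρ') • ρ + deriv w (τ * inner ℝ x ρ') • ρ') := by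
  have h1 : HasFDerivAt (wolffSol w ρ ρ' t τ) _ x :=
    hasFDerivAt_exp_mul_comp (ρ := ρ) (c := τ) (t := t) (h.hasDerivAt (τ * inner ℝ x ρ'))
  rw [gradient, h1.fderiv]
  refine ext_inner_right ℝ fun v => ?_
  rw [InnerProductSpace.toDual_symm_apply]
  simp [inner_add_left, real_inner_smul_left]
  ring

theorem norm_sq_smul_add_smul {ρ ρ' : Eu n} (hρ : ‖ρ‖ = 1) (hρ' : ‖ρ'‖ = 1)
    (hperp : inner ℝ ρ ρ' = 0) (a b : ℝ) : ‖a • ρ + b • ρ'‖ ^ 2 = a ^ 2 + b ^ 2 := by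
  rw [norm_add_sq_real, real_inner_smul_left, real_inner_smul_right, hperp, norm_smul, norm_smul,
    hρ, hρ']
  simp

theorem norm_smul_add_smul_rpow {ρ ρ' : Eu n} (hρ : ‖ρ‖ = 1) (hρ' : ‖ρ'‖ = 1)
    (hperp : inner ℝ ρ ρ' = 0) (a b q : ℝ) :
    ‖a • ρ + b • ρ'‖ ^ q = (a ^ 2 + b ^ 2) ^ (q / 2) := by
  rw [← norm_sq_smul_add_smul hρ hρ' hperp, ← Real.rpow_natCast, ← Real.rpow_mul (norm_nonneg _)]
  congr 1
  push_cast
  ring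

theorem IsWolffProfile.norm_gradient_rpow (h : IsWolffProfile p a₀ b₀ w) {ρ ρ' : Eu n}
    (hρ : ‖ρ‖ = 1) (hρ' : ‖ρ'‖ = 1) (hperp : inner ℝ ρ ρ' = 0) (t : ℝ) {τ : ℝ} (hτ : 0 < τ)
    (q : ℝ) (x : Eu n) : ‖gradient (wolffSol w ρ ρ' t τ) x‖ ^ q =
      τ ^ q * (Real.exp (q * τ * (inner ℝ x ρ - t)) *
        (w (τ * inner ℝ x ρ') ^ 2 + deriv w (τ * inner ℝ x ρ') ^ 2) ^ (q / 2)) := by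
  rw [h.gradient_wolffSol, norm_smul, Real.norm_of_nonneg (by positivity),
    Real.mul_rpow (by positivity) (norm_nonneg _), Real.mul_rpow hτ.le (Real.exp_pos _).le,
    norm_smul_add_smul_rpow hρ hρ' hperp, ← Real.exp_mul, mul_assoc]
  ring_nf

theorem IsWolffProfile.contDiff_rpow (hp : 1 < p) (hab : (a₀, b₀) ≠ (0, 0))
    (h : IsWolffProfile p a₀ b₀ w) (q : ℝ) :
    ContDiff ℝ ∞ fun s => (w s ^ 2 + deriv w s ^ 2) ^ q :=
  ((h.1.pow 2).add (h.contDiff_deriv.pow 2)).rpow_const_of_ne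
    fun s => (h.sq_add_sq_pos hp hab s).ne'

/-- The weak form of the `p`-Laplace equation for Wolff solutions. -/
theorem IsWolffProfile.integral_flux_eq_zero (hp : 1 < p) (hab : (a₀, b₀) ≠ (0, 0))
    (h : IsWolffProfile p a₀ b₀ w) {ρ ρ' : Eu n}
    (hρ : ‖ρ‖ = 1) (hρ' : ‖ρ'‖ = 1) (hperp : inner ℝ ρ ρ' = 0) (t : ℝ) {τ : ℝ} (hτ : 0 < τ)
    {φ : Eu n → ℝ} (hφ : ContDiff ℝ 1 φ) (hφs : HasCompactSupport φ) :
    ∫ x, ‖gradient (wolffSol w ρ ρ' t τ) x‖ ^ (p - 2) *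
      inner ℝ (gradient (wolffSol w ρ ρ' t τ) x) (gradient φ x) = 0 := by
  set W₁ : ℝ → ℝ := fun s => (w s ^ 2 + deriv w s ^ 2) ^ ((p - 2) / 2) * w s with hW₁
  set W₂ : ℝ → ℝ := fun s => (w s ^ 2 + deriv w s ^ 2) ^ ((p - 2) / 2) * deriv w s with hW₂
  have hW₁c : ContDiff ℝ ∞ W₁ := (h.contDiff_rpow hp hab _).mul h.1
  have hW₂c : ContDiff ℝ ∞ W₂ := (h.contDiff_rpow hp hab _).mul h.contDiff_deriv
  -- Up to the factor `τ^{p-1}`, `g₁` and `g₂` are the components of `|∇u|^{p-2}∇u` along `ρ` and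
  -- `ρ'`. The derivatives `hd₁` and `hd₂` cancel, so the flux is divergence free.
  set g₁ : Eu n → ℝ := fun y =>
    Real.exp ((p - 1) * τ * (inner ℝ y ρ - t)) * W₁ (τ * inner ℝ y ρ') with hg₁
  set g₂ : Eu n → ℝ := fun y =>
    Real.exp ((p - 1) * τ * (inner ℝ y ρ - t)) * W₂ (τ * inner ℝ y ρ') with hg₂
  have hg₁c : ContDiff ℝ 1 g₁ := (contDiff_exp_mul_comp hW₁c).of_le (by simp)
  have hg₂c : ContDiff ℝ 1 g₂ := (contDiff_exp_mul_comp hW₂c).of_le (by simp)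
  have hperp' : inner ℝ ρ' ρ = 0 := by rw [real_inner_comm, hperp]
  have hd₁ : ∀ x, fderiv ℝ g₁ x ρ = (p - 1) * τ * g₁ x := by
    intro x
    have h1 := hasFDerivAt_exp_mul_comp (ρ := ρ) (ρ' := ρ') (c := (p - 1) * τ) (t := t)
      (x := x) (τ := τ) (hW₁c.differentiable (by simp) (τ * inner ℝ x ρ')).hasDerivAt
    rw [hg₁, h1.fderiv]
    simp [hperp', hρ]
    ring
  have hd₂ : ∀ x, fderiv ℝ g₂ x ρ' = -((p - 1) * τ * g₁ x) := by
    intro x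
    have h1 := hasFDerivAt_exp_mul_comp (ρ := ρ) (ρ' := ρ') (c := (p - 1) * τ) (t := t)
      (x := x) (τ := τ) (h.hasDerivAt_flux hp hab (τ * inner ℝ x ρ'))
    rw [hg₂, h1.fderiv]
    simp [hperp, hρ', hg₁, hW₁]
    ring
  have hparts : ∀ g : Eu n → ℝ, ContDiff ℝ 1 g → ∀ v : Eu n,
      ∫ x, g x * fderiv ℝ φ x v = -∫ x, fderiv ℝ g x v * φ x := by
    intro g hg v
    have hcg : Continuous fun x => fderiv ℝ g x v :=
      (hg.continuous_fderiv (by simp)).clm_apply continuous_const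
    have hcφ : Continuous fun x => fderiv ℝ φ x v :=
      (hφ.continuous_fderiv (by simp)).clm_apply continuous_const
    exact integral_mul_fderiv_eq_neg_fderiv_mul_of_integrable
      ((hcg.mul hφ.continuous).integrable_of_hasCompactSupport hφs.mul_left)
      ((hg.continuous.mul hcφ).integrable_of_hasCompactSupport (hφs.fderiv_apply ℝ v).mul_left)
      ((hg.continuous.mul hφ.continuous).integrable_of_hasCompactSupport hφs.mul_left)
      (fun x _ => hg.differentiable (by simp) x) (fun x _ => hφ.differentiable (by simp) x)
  have hint : ∀ g : Eu n → ℝ, ContDiff ℝ 1 g → ∀ v : Eu n,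
      Integrable fun x => g x * fderiv ℝ φ x v := by
    intro g hg v
    have hcφ : Continuous fun x => fderiv ℝ φ x v :=
      (hφ.continuous_fderiv (by simp)).clm_apply continuous_const
    exact (hg.continuous.mul hcφ).integrable_of_hasCompactSupport
      (hφs.fderiv_apply ℝ v).mul_left
  have hpt : ∀ x, ‖gradient (wolffSol w ρ ρ' t τ) x‖ ^ (p - 2) *
      inner ℝ (gradient (wolffSol w ρ ρ' t τ) x) (gradient φ x) =
      τ ^ (p - 1) * (g₁ x * fderiv ℝ φ x ρ + g₂ x * fderiv ℝ φ x ρ') := by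
    intro x
    have hi : ∀ v, inner ℝ v (gradient φ x) = fderiv ℝ φ x v := fun v => by
      rw [real_inner_comm, gradient, InnerProductSpace.toDual_symm_apply]
    rw [h.norm_gradient_rpow hρ hρ' hperp t hτ, hi, h.gradient_wolffSol]
    have e1 : τ ^ (p - 1) = τ ^ (p - 2) * τ := by
      rw [← Real.rpow_add_one hτ.ne']
      ring_nf
    have e2 : Real.exp ((p - 1) * τ * (inner ℝ x ρ - t)) =
        Real.exp ((p - 2) * τ * (inner ℝ x ρ - t)) * Real.exp (τ * (inner ℝ x ρ - t)) := by
      rw [← Real.exp_add]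
      ring_nf
    simp only [hg₁, hg₂, hW₁, hW₂, e1, e2, map_smul, map_add, smul_eq_mul]
    ring
  simp only [hpt]
  rw [integral_const_mul, integral_add (hint g₁ hg₁c ρ) (hint g₂ hg₂c ρ'), hparts g₁ hg₁c,
    hparts g₂ hg₂c]
  simp only [hd₁, hd₂, neg_mul, integral_neg]
  simp

variable [hp : Fact (1 < p)]

/-- The flux functional is continuous, so the weak equation passes from test functions to their
closure. -/
theorem IsWolffProfile.flux_eq_zero (hab : (a₀, b₀) ≠ (0, 0)) (h : IsWolffProfile p a₀ b₀ w)
    (hΩb : Bornology.IsBounded Ω) (hΩ : IsOpen Ω) {ρ ρ' : Eu n}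
    (hρ : ‖ρ‖ = 1) (hρ' : ‖ρ'‖ = 1) (hperp : inner ℝ ρ ρ' = 0) (t : ℝ) {τ : ℝ} (hτ : 0 < τ)
    {U : W1p p Ω} (hU : sobGrad U =ᵐ[volume.restrict Ω] gradient (wolffSol w ρ ρ' t τ))
    {v : W1p p Ω} (hv : v ∈ W01p p Ω) : (lInftyPlus_one (Ω := Ω)).flux U v = 0 := by
  have hcl : IsClosed {v : W1p p Ω | (lInftyPlus_one (Ω := Ω)).flux U v = 0} :=
    isClosed_eq (ContinuousLinearMap.continuous _) continuous_const
  refine closure_minimal (fun z hz => ?_) hcl hv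
  obtain ⟨φ, hφ, hzφ⟩ := hz
  have hφd : ContDiff ℝ 1 φ := hφ.1.of_le (by simp)
  have hgr := sobGrad_ae_eq_gradient hΩb hΩ hφd hzφ
  refine (LInftyPlus.flux_apply _ U z).trans ?_
  rw [← h.integral_flux_eq_zero hp.out hab hρ hρ' hperp t hτ hφd hφ.2.1,
    ← setIntegral_eq_integral_of_forall_compl_eq_zero (s := Ω)
      (f := fun x => ‖gradient (wolffSol w ρ ρ' t τ) x‖ ^ (p - 2) *
        inner ℝ (gradient (wolffSol w ρ ρ' t τ) x) (gradient φ x))]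
  · refine integral_congr_ae ?_
    filter_upwards [hU, hgr] with x h1 h2
    rw [h1, h2, one_mul]
  · intro x hx
    have h0 : fderiv ℝ φ x = 0 :=
      image_eq_zero_of_notMem_tsupport fun h => hx (hφ.2.2 (tsupport_fderiv_subset ℝ h))
    simp [gradient, h0]

/-- Whichever representative the choice in `bdryValue` picks, uniqueness of weak gradients
identifies its gradient. -/
theorem exists_bdryValue_eq (hΩb : Bornology.IsBounded Ω) (hΩ : IsOpen Ω) {u : Eu n → ℝ}
    (hu : ContDiff ℝ 1 u) :
    ∃ U : W1p p Ω, bdryValue p Ω u = bdryTrace p Ω U ∧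
      sobGrad U =ᵐ[volume.restrict Ω] gradient u := by
  have h : ∃ v : W1p p Ω, sobFn v =ᵐ[volume.restrict Ω] u := by
    obtain ⟨v, hv, -⟩ := exists_W1p_of_contDiff hΩb hΩ p hu
    exact ⟨v, hv⟩
  refine ⟨h.choose, ?_, sobGrad_ae_eq_gradient hΩb hΩ hu h.choose_spec⟩
  rw [bdryValue, dif_pos h]

/-! ### Bounds for the indicator function -/

/-- `τ^{-p} |∇u_τ|^p` for the Wolff solution `u_τ`. -/
def wolffDensity (p : ℝ) (w : ℝ → ℝ) (ρ ρ' : Eu n) (t τ : ℝ) (x : Eu n) : ℝ :=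
  Real.exp (p * τ * (inner ℝ x ρ - t)) *
    (w (τ * inner ℝ x ρ') ^ 2 + deriv w (τ * inner ℝ x ρ') ^ 2) ^ (p / 2)

set_option maxHeartbeats 1000000 in
theorem IsWolffProfile.indicatorFun_bounds (hn : 1 ≤ n) (hab : (a₀, b₀) ≠ (0, 0))
    (h : IsWolffProfile p a₀ b₀ w) (hΩb : Bornology.IsBounded Ω) (hΩ : IsOpen Ω)
    (hσ : LInftyPlus Ω σ) {ρ ρ' : Eu n}
    (hρ : ‖ρ‖ = 1) (hρ' : ‖ρ'‖ = 1) (hperp : inner ℝ ρ ρ' = 0) (t : ℝ) {τ : ℝ} (hτ : 0 < τ) :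
    (p - 1) * ∫ x in Ω, (1 - σ x ^ (-1 / (p - 1))) * wolffDensity p w ρ ρ' t τ x ≤
      indicatorFun p Ω σ w ρ ρ' t τ ∧
    indicatorFun p Ω σ w ρ ρ' t τ ≤ ∫ x in Ω, (σ x - 1) * wolffDensity p w ρ ρ' t τ x := by
  obtain ⟨U, hU, hUg⟩ := exists_bdryValue_eq (p := p) hΩb hΩ
    ((h.contDiff_wolffSol ρ ρ' t τ).of_le (by simp))
  have hb := hσ.dnMap_sub_bounds hn hΩb hΩ (u := U)
    fun φ hφ => h.flux_eq_zero hab hΩb hΩ hρ hρ' hperp t hτ hUg hφ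
  have hint : ∀ k : Eu n → ℝ, ∫ x in Ω, k x * ‖sobGrad U x‖ ^ p =
      τ ^ p * ∫ x in Ω, k x * wolffDensity p w ρ ρ' t τ x := by
    intro k
    rw [← integral_const_mul]
    refine integral_congr_ae ?_
    filter_upwards [hUg] with x hx
    rw [hx, h.norm_gradient_rpow hρ hρ' hperp t hτ, wolffDensity]
    ring
  rw [hint, hint] at hb
  rw [indicatorFun, hU]
  generalize (dnMap p Ω σ (bdryTrace p Ω U) - dnMap p Ω (fun _ => 1) (bdryTrace p Ω U))
    (bdryTrace p Ω U) = y at hb ⊢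
  have hτp : 0 < τ ^ p := by positivity
  rw [Real.rpow_neg hτ.le]
  constructor
  · rw [le_inv_mul_iff₀ hτp]
    linarith [hb.1]
  · rw [inv_mul_le_iff₀ hτp]
    exact hb.2

end

/-! ### Asymptotics of the indicator function -/

section Asymptotics

variable {n : ℕ} {p : ℝ} {Ω : Set (Eu n)} {σ η : Eu n → ℝ} {w : ℝ → ℝ} {a₀ b₀ : ℝ}

theorem IsWolffProfile.continuous_wolffDensity (hp : 1 < p) (h : IsWolffProfile p a₀ b₀ w)
    (ρ ρ' : Eu n) (t τ : ℝ) : Continuous (wolffDensity p w ρ ρ' t τ) := by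
  have h1 : Continuous fun x : Eu n => w (τ * inner ℝ x ρ') :=
    h.1.continuous.comp (by fun_prop)
  have h2 : Continuous fun x : Eu n => deriv w (τ * inner ℝ x ρ') :=
    h.contDiff_deriv.continuous.comp (by fun_prop)
  exact (by fun_prop : Continuous fun x : Eu n => Real.exp (p * τ * (inner ℝ x ρ - t))).mul
    (((h1.pow 2).add (h2.pow 2)).rpow_const fun _ => Or.inr (by linarith))

theorem IsWolffProfile.integrable_mul_wolffDensity (hp : 1 < p) (h : IsWolffProfile p a₀ b₀ w)
    (hΩb : Bornology.IsBounded Ω) (hΩ : IsOpen Ω) (hη : MemLp η ⊤ (volume.restrict Ω))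
    (ρ ρ' : Eu n) (t τ : ℝ) :
    Integrable (fun x => η x * wolffDensity p w ρ ρ' t τ x) (volume.restrict Ω) :=
  integrable_mul_of_memLp_top hη (memLp_one_iff_integrable.1
    (memLp_of_continuous hΩb hΩ (h.continuous_wolffDensity hp ρ ρ' t τ) 1))

/-- Where `η` does not vanish the exponent is at most `pτ(s - t)`, so the integrand is uniformly
exponentially small on a set of finite measure. -/
theorem IsWolffProfile.tendsto_integral_zero (hp : 1 < p) (hab : (a₀, b₀) ≠ (0, 0))
    (h : IsWolffProfile p a₀ b₀ w) (hΩb : Bornology.IsBounded Ω)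
    {B : ℝ} (hB : ∀ᵐ x ∂(volume.restrict Ω), |η x| ≤ B) {ρ ρ' : Eu n} {s t : ℝ} (hst : s < t)
    (hs : ∀ᵐ x ∂(volume.restrict Ω), s < inner ℝ x ρ → η x = 0) :
    Tendsto (fun τ => ∫ x in Ω, η x * wolffDensity p w ρ ρ' t τ x) atTop (𝓝 0) := by
  obtain ⟨m, M, hm, hmM⟩ := h.exists_bounds hp hab
  have := isFiniteMeasure_restrict hΩb
  have hbound : ∀ τ : ℝ, 0 < τ → ‖∫ x in Ω, η x * wolffDensity p w ρ ρ' t τ x‖ ≤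
      |B| * (Real.exp (p * τ * (s - t)) * M ^ (p / 2)) * (volume.restrict Ω).real Set.univ := by
    intro τ hτ
    refine norm_integral_le_of_norm_le_const ?_
    filter_upwards [hB, hs] with x h1 h2
    have hM : 0 ≤ M := hm.le.trans ((hmM 0).1.trans (hmM 0).2)
    rcases lt_or_ge s (inner ℝ x ρ) with h3 | h3
    · rw [h2 h3, zero_mul, norm_zero]
      positivity
    · have h4 := hmM (τ * inner ℝ x ρ')
      have h5 : 0 ≤ wolffDensity p w ρ ρ' t τ x := by
        rw [wolffDensity]
        positivity
      rw [norm_mul, Real.norm_eq_abs, Real.norm_of_nonneg h5]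
      refine mul_le_mul (h1.trans (le_abs_self B)) ?_ h5 (abs_nonneg _)
      rw [wolffDensity]
      gcongr
      exact h4.2
  refine squeeze_zero_norm' (eventually_atTop.2 ⟨1, fun τ hτ => hbound τ (by linarith)⟩) ?_
  have h1 : Tendsto (fun τ : ℝ => p * τ * (s - t)) atTop atBot := by
    have : (fun τ : ℝ => p * τ * (s - t)) = fun τ => (p * (s - t)) * τ := by
      funext τ
      ring
    rw [this]
    exact tendsto_id.const_mul_atTop_of_neg (mul_neg_of_pos_of_neg (by linarith) (by linarith))
  have h2 := (((Real.tendsto_exp_atBot.comp h1).mul_const (M ^ (p / 2))).const_mul |B|).mul_const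
    ((volume.restrict Ω).real Set.univ)
  simpa using h2

/-- On `x·ρ > s` the density is at least `m^{p/2} e^{pτ(s-t)}`, and `η` has positive mass `A` there.
The rest of the integral is nonnegative. -/
theorem IsWolffProfile.tendsto_integral_atTop (hp : 1 < p) (hab : (a₀, b₀) ≠ (0, 0))
    (h : IsWolffProfile p a₀ b₀ w) (hΩb : Bornology.IsBounded Ω) (hΩ : IsOpen Ω)
    (hη : MemLp η ⊤ (volume.restrict Ω)) (hη0 : ∀ᵐ x ∂(volume.restrict Ω), 0 ≤ η x)
    {ρ ρ' : Eu n} {s t : ℝ} (hst : t < s)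
    (hs : ¬ ∀ᵐ x ∂(volume.restrict Ω), s < inner ℝ x ρ → η x = 0) :
    Tendsto (fun τ => ∫ x in Ω, η x * wolffDensity p w ρ ρ' t τ x) atTop atTop := by
  obtain ⟨m, M, hm, hmM⟩ := h.exists_bounds hp hab
  have := isFiniteMeasure_restrict hΩb
  have hηi : Integrable η (volume.restrict Ω) := hη.integrable le_top
  set S : Set (Eu n) := {x | s < inner ℝ x ρ} with hS
  have hSm : MeasurableSet S := (isOpen_lt (by fun_prop) (by fun_prop)).measurableSet
  have hind0 : ∀ᵐ x ∂(volume.restrict Ω), 0 ≤ S.indicator η x := by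
    filter_upwards [hη0] with x hx
    exact Set.indicator_apply_nonneg fun _ => hx
  set A := ∫ x in Ω, S.indicator η x with hA
  have hA0 : 0 < A := by
    refine (integral_nonneg_of_ae hind0).lt_of_ne fun h0 => hs ?_
    have h1 := (integral_eq_zero_iff_of_nonneg_ae hind0 (hηi.indicator hSm)).1 h0.symm
    filter_upwards [h1] with x hx hxs
    rwa [Set.indicator_of_mem (show x ∈ S from hxs)] at hx
  have hbound : ∀ τ : ℝ, 0 < τ → m ^ (p / 2) * A * Real.exp (p * τ * (s - t)) ≤
      ∫ x in Ω, η x * wolffDensity p w ρ ρ' t τ x := by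
    intro τ hτ
    rw [hA, mul_right_comm, ← integral_const_mul]
    refine integral_mono_ae ((hηi.indicator hSm).const_mul _)
      (h.integrable_mul_wolffDensity hp hΩb hΩ hη ρ ρ' t τ) ?_
    filter_upwards [hη0] with x hx
    have h5 : 0 ≤ wolffDensity p w ρ ρ' t τ x := by
      have := (hmM (τ * inner ℝ x ρ')).1
      rw [wolffDensity]
      positivity
    by_cases hxS : x ∈ S
    · rw [Set.indicator_of_mem hxS, mul_comm]
      refine mul_le_mul_of_nonneg_left ?_ hx
      rw [wolffDensity, mul_comm]
      have hxs : s ≤ inner ℝ x ρ := le_of_lt hxS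
      have := (hmM (τ * inner ℝ x ρ')).1
      gcongr
    · rw [Set.indicator_of_notMem hxS, mul_zero]
      positivity
  refine tendsto_atTop_mono' atTop (eventually_atTop.2 ⟨1, fun τ hτ => hbound τ (by linarith)⟩) ?_
  refine Tendsto.const_mul_atTop (by positivity) (Real.tendsto_exp_atTop.comp ?_)
  have : (fun τ : ℝ => p * τ * (s - t)) = fun τ => (p * (s - t)) * τ := by
    funext τ
    ring
  rw [this]
  exact tendsto_id.const_mul_atTop (mul_pos (by linarith) (by linarith))

theorem one_sub_rpow_eq_zero_iff (hp : 1 < p) {s : ℝ} (hs : 0 < s) :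
    1 - s ^ (-1 / (p - 1)) = 0 ↔ s = 1 := by
  have hq : -1 / (p - 1) ≠ 0 := div_ne_zero (by norm_num) (by linarith)
  rw [sub_eq_zero, eq_comm, ← Real.rpow_left_inj hs.le zero_le_one hq, Real.one_rpow]

variable [hp : Fact (1 < p)]

theorem LInftyPlus.memLp_one_sub_rpow (hσ : LInftyPlus Ω σ) :
    MemLp (fun x => 1 - σ x ^ (-1 / (p - 1))) ⊤ (volume.restrict Ω) :=
  (memLp_top_const 1).sub (hσ.rpow_memLp_top
    (div_nonpos_of_nonpos_of_nonneg (by norm_num) (by linarith [hp.out])))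

theorem exists_ae_abs_le_of_memLp_top (hη : MemLp η ⊤ (volume.restrict Ω)) :
    ∃ B : ℝ, ∀ᵐ x ∂(volume.restrict Ω), |η x| ≤ B := by
  refine ⟨(eLpNorm η ⊤ (volume.restrict Ω)).toReal, ?_⟩
  have hb : ∀ᵐ x ∂(volume.restrict Ω), ‖η x‖ₑ ≤ eLpNorm η ⊤ (volume.restrict Ω) := by
    rw [eLpNorm_exponent_top]
    exact ae_le_eLpNormEssSup
  filter_upwards [hb] with x hx
  have h3 := ENNReal.toReal_mono hη.2.ne hx
  rwa [toReal_enorm] at h3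

/-- Both bounds tend to zero; no sign of `σ - 1` is involved. -/
theorem IsWolffProfile.tendsto_indicatorFun_zero (hn : 1 ≤ n) (hab : (a₀, b₀) ≠ (0, 0))
    (h : IsWolffProfile p a₀ b₀ w) (hΩb : Bornology.IsBounded Ω) (hΩ : IsOpen Ω)
    (hσ : LInftyPlus Ω σ) {ρ ρ' : Eu n}
    (hρ : ‖ρ‖ = 1) (hρ' : ‖ρ'‖ = 1) (hperp : inner ℝ ρ ρ' = 0) {s t : ℝ} (hst : s < t)
    (hs : ∀ᵐ x ∂(volume.restrict Ω), s < inner ℝ x ρ → σ x = 1) :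
    Tendsto (fun τ => indicatorFun p Ω σ w ρ ρ' t τ) atTop (𝓝 0) := by
  obtain ⟨B, hB⟩ := exists_ae_abs_le_of_memLp_top (hσ.1.sub (memLp_top_const 1))
  obtain ⟨B', hB'⟩ := exists_ae_abs_le_of_memLp_top (hσ.memLp_one_sub_rpow (p := p))
  have h1 := h.tendsto_integral_zero hp.out hab hΩb hB (ρ := ρ) (ρ' := ρ') hst (by
    filter_upwards [hs] with x hx hxs
    simp [hx hxs])
  have h2 := (h.tendsto_integral_zero hp.out hab hΩb hB' (ρ := ρ) (ρ' := ρ') hst (by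
    filter_upwards [hs] with x hx hxs
    simp [hx hxs])).const_mul (p - 1)
  rw [mul_zero] at h2
  have hev := fun (τ : ℝ) (hτ : 1 ≤ τ) => h.indicatorFun_bounds hn hab hΩb hΩ hσ hρ hρ' hperp t
    (by linarith : 0 < τ)
  exact tendsto_of_tendsto_of_tendsto_of_le_of_le' h2 h1
    (eventually_atTop.2 ⟨1, fun τ hτ => (hev τ hτ).1⟩)
    (eventually_atTop.2 ⟨1, fun τ hτ => (hev τ hτ).2⟩)

theorem IsWolffProfile.tendsto_indicatorFun_atTop (hn : 1 ≤ n) (hab : (a₀, b₀) ≠ (0, 0))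
    (h : IsWolffProfile p a₀ b₀ w) (hΩb : Bornology.IsBounded Ω) (hΩ : IsOpen Ω)
    (hσ : LInftyPlus Ω σ) (hσ1 : ∀ᵐ x ∂(volume.restrict Ω), 1 ≤ σ x) {ρ ρ' : Eu n}
    (hρ : ‖ρ‖ = 1) (hρ' : ‖ρ'‖ = 1) (hperp : inner ℝ ρ ρ' = 0) {s t : ℝ} (hst : t < s)
    (hs : ¬ ∀ᵐ x ∂(volume.restrict Ω), s < inner ℝ x ρ → σ x = 1) :
    Tendsto (fun τ => indicatorFun p Ω σ w ρ ρ' t τ) atTop atTop := by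
  have hp1 : 0 < p - 1 := by linarith [hp.out]
  have h1 := h.tendsto_integral_atTop hp.out hab hΩb hΩ (hσ.memLp_one_sub_rpow (p := p)) (by
    filter_upwards [hσ1] with x hx
    exact sub_nonneg.2 (Real.rpow_le_one_of_one_le_of_nonpos hx
      (div_nonpos_of_nonpos_of_nonneg (by norm_num) hp1.le))) (ρ := ρ) (ρ' := ρ') hst (by
    refine fun hs' => hs ?_
    filter_upwards [hs', hσ1] with x hx hx1 hxs
    exact (one_sub_rpow_eq_zero_iff hp.out (by linarith)).1 (hx hxs))
  exact tendsto_atTop_mono' atTop (eventually_atTop.2 ⟨1, fun τ hτ =>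
    (h.indicatorFun_bounds hn hab hΩb hΩ hσ hρ hρ' hperp t (by linarith : 0 < τ)).1⟩)
    (h1.const_mul_atTop hp1)

/-- Here the upper bound does the work: its weight is minus the nonnegative function `1 - σ`. -/
theorem IsWolffProfile.tendsto_indicatorFun_atBot (hn : 1 ≤ n) (hab : (a₀, b₀) ≠ (0, 0))
    (h : IsWolffProfile p a₀ b₀ w) (hΩb : Bornology.IsBounded Ω) (hΩ : IsOpen Ω)
    (hσ : LInftyPlus Ω σ) (hσ1 : ∀ᵐ x ∂(volume.restrict Ω), σ x ≤ 1) {ρ ρ' : Eu n}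
    (hρ : ‖ρ‖ = 1) (hρ' : ‖ρ'‖ = 1) (hperp : inner ℝ ρ ρ' = 0) {s t : ℝ} (hst : t < s)
    (hs : ¬ ∀ᵐ x ∂(volume.restrict Ω), s < inner ℝ x ρ → σ x = 1) :
    Tendsto (fun τ => indicatorFun p Ω σ w ρ ρ' t τ) atTop atBot := by
  have h1 := h.tendsto_integral_atTop hp.out hab hΩb hΩ
    (η := fun x => 1 - σ x) ((memLp_top_const 1).sub hσ.1) (by
    filter_upwards [hσ1] with x hx
    exact sub_nonneg.2 hx) (ρ := ρ) (ρ' := ρ') hst (by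
    refine fun hs' => hs ?_
    filter_upwards [hs'] with x hx hxs
    linarith [hx hxs])
  refine tendsto_atBot_mono' atTop (eventually_atTop.2 ⟨1, fun τ hτ =>
    (h.indicatorFun_bounds hn hab hΩb hΩ hσ hρ hρ' hperp t (by linarith : 0 < τ)).2⟩)
    ((tendsto_neg_atTop_atBot.comp h1).congr fun τ => ?_)
  rw [Function.comp_apply, ← integral_neg]
  congr 1
  funext x
  ring

end Asymptotics

/-! ### The essential support and its essential convex hull -/

section Hull

variable {n : ℕ} {Ω : Set (Eu n)} {f : Eu n → ℝ}

/-- By the Lindelöf property, countably many of the removed open sets cover their union, so the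
exceptional null sets add up to a null set. -/
theorem ae_eq_zero_of_notMem_essSupp (hΩ : IsOpen Ω) :
    ∀ᵐ x ∂(volume.restrict Ω), x ∉ essSupp Ω f → f x = 0 := by
  set C : Set (Set (Eu n)) :=
    {O | IsOpen O ∧ O ⊆ Ω ∧ ∀ᵐ x ∂(volume.restrict O), f x = 0} with hC
  obtain ⟨T, hTC, hT, hTU⟩ := TopologicalSpace.isOpen_sUnion_countable C fun O hO => hO.1
  have h1 : ∀ᵐ x, ∀ O ∈ T, x ∈ O → f x = 0 := by
    rw [ae_ball_iff hTC]
    intro O hO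
    have := (hT hO).2.2
    rwa [ae_restrict_iff' (hT hO).1.measurableSet] at this
  filter_upwards [ae_restrict_of_ae h1, ae_restrict_mem hΩ.measurableSet] with x hx hxΩ hxs
  have h2 : x ∈ ⋃₀ C := by
    by_contra h
    exact hxs ⟨hxΩ, h⟩
  rw [← hTU] at h2
  obtain ⟨O, hO, hxO⟩ := h2
  exact hx O hO hxO

/-- Translates the geometry of `D` into a statement on `σ`. If `f = 0` a.e. beyond the hyperplane,
that part of `Ω` is one of the removed open sets. -/
theorem volume_essSupp_diff_halfSpace_eq_zero_iff (hΩ : IsOpen Ω) (ρ : Eu n) (t : ℝ) :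
    volume (essSupp Ω f \ halfSpace ρ t) = 0 ↔
      ∀ᵐ x ∂(volume.restrict Ω), t < inner ℝ x ρ → f x = 0 := by
  constructor
  · intro h
    have h1 : ∀ᵐ x, x ∉ essSupp Ω f \ halfSpace ρ t := measure_eq_zero_iff_ae_notMem.1 h
    filter_upwards [ae_restrict_of_ae h1, ae_eq_zero_of_notMem_essSupp (f := f) hΩ]
      with x hx hx' ht
    exact hx' fun hs => hx ⟨hs, fun hh => absurd ht (not_lt.2 hh)⟩
  · intro h
    have hopen : IsOpen (Ω ∩ {x : Eu n | t < inner ℝ x ρ}) :=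
      hΩ.inter (isOpen_lt (by fun_prop) (by fun_prop))
    have hmem : ∀ᵐ x ∂(volume.restrict (Ω ∩ {x : Eu n | t < inner ℝ x ρ})), f x = 0 := by
      filter_upwards [ae_restrict_of_ae_restrict_of_subset Set.inter_subset_left h,
        ae_restrict_mem hopen.measurableSet] with x hx hxm
      exact hx hxm.2
    have hempty : essSupp Ω f \ halfSpace ρ t = ∅ := by
      refine Set.eq_empty_of_forall_notMem ?_
      rintro x ⟨⟨hxΩ, hx⟩, hxt⟩
      have ht : t < inner ℝ x ρ := lt_of_not_ge fun hle => hxt hle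
      exact hx ⟨_, ⟨hopen, Set.inter_subset_left, hmem⟩, hxΩ, ht⟩
    rw [hempty, measure_empty]

theorem essSupportFun_set_nonempty {A : Set (Eu n)} (hA : Bornology.IsBounded A) (ρ : Eu n)
    (hρ : ‖ρ‖ = 1) : {t : ℝ | volume (A \ halfSpace ρ t) = 0}.Nonempty := by
  obtain ⟨R, hR⟩ := hA.exists_norm_le
  refine ⟨R, ?_⟩
  have : A \ halfSpace ρ R = ∅ := Set.sdiff_eq_empty.2 fun x hx => by
    have := real_inner_le_norm x ρ
    rw [hρ, mul_one] at this
    exact this.trans (hR x hx)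
  simp [this]

theorem essSupportFun_set_bddBelow {A : Set (Eu n)} (hA : Bornology.IsBounded A)
    (hA0 : volume A ≠ 0) (ρ : Eu n) (hρ : ‖ρ‖ = 1) :
    BddBelow {t : ℝ | volume (A \ halfSpace ρ t) = 0} := by
  obtain ⟨R, hR⟩ := hA.exists_norm_le
  refine ⟨-R, fun t ht => ?_⟩
  by_contra! hlt
  have : A \ halfSpace ρ t = A := by
    refine sdiff_eq_left.2 (Set.disjoint_left.2 fun x hx hxt => ?_)
    have h1 := (abs_le.1 (abs_real_inner_le_norm x ρ)).1
    rw [hρ, mul_one] at h1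
    have h2 : inner ℝ x ρ ≤ t := hxt
    linarith [hR x hx]
  rw [Set.mem_ofPred_eq, this] at ht
  exact hA0 ht

theorem mem_cessco_iff {A : Set (Eu n)} (hA : Bornology.IsBounded A) (hA0 : volume A ≠ 0)
    {x : Eu n} : x ∈ cessco A ↔ ∀ ρ : Eu n, ‖ρ‖ = 1 → inner ℝ x ρ ≤ essSupportFun A ρ := by
  constructor
  · intro hx ρ hρ
    exact le_csInf (essSupportFun_set_nonempty hA ρ hρ) fun t ht => hx ρ t ht
  · intro hx ρ t ht
    -- For `ρ = 0` the half-space is everything or empty, and empty is excluded because `A` is not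
    -- null. Other normals are rescaled to unit length.
    rcases eq_or_ne ρ 0 with rfl | hρ
    · by_contra hxt
      have h1 : ¬ (inner ℝ x (0 : Eu n) ≤ t) := hxt
      have h2 : A \ halfSpace 0 t = A := by
        refine sdiff_eq_left.2 (Set.disjoint_left.2 fun y _ hy => h1 ?_)
        rw [inner_zero_right]
        simpa [halfSpace] using hy
      rw [h2] at ht
      exact hA0 ht
    · have hpos : 0 < ‖ρ‖ := norm_pos_iff.2 hρ
      have hscale : halfSpace ρ t = halfSpace (‖ρ‖⁻¹ • ρ) (‖ρ‖⁻¹ * t) := by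
        ext y
        simp only [halfSpace, Set.mem_ofPred_eq, real_inner_smul_right]
        exact (mul_le_mul_iff_of_pos_left (inv_pos.2 hpos)).symm
      have hunit : ‖‖ρ‖⁻¹ • ρ‖ = 1 := by
        rw [norm_smul, norm_inv, norm_norm, inv_mul_cancel₀ hpos.ne']
      rw [hscale] at ht ⊢
      exact (hx _ hunit).trans (csInf_le (essSupportFun_set_bddBelow hA hA0 _ hunit) ht)

/-- The degenerate half-space with `ρ = 0` and `t = -1` is empty and contains almost all of a null
set. -/
theorem cessco_of_volume_eq_zero {A : Set (Eu n)} (hA : volume A = 0) : cessco A = ∅ := by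
  refine Set.eq_empty_of_forall_notMem fun x hx => ?_
  have h : inner ℝ x (0 : Eu n) ≤ -1 := hx 0 (-1) (measure_mono_null Set.sdiff_subset hA)
  rw [inner_zero_right] at h
  norm_num at h

/-- A set between an open half-space and its closure has the closed half-space as closure, so the
behaviour at `t = h_D(ρ)` is irrelevant. -/
theorem mem_closure_iff_inner_le {H : Set (Eu n)} {ρ : Eu n} (hρ : ‖ρ‖ = 1) {h : ℝ}
    (h1 : ∀ x, inner ℝ x ρ < h → x ∈ H) (h2 : ∀ x ∈ H, inner ℝ x ρ ≤ h) {x : Eu n} :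
    x ∈ closure H ↔ inner ℝ x ρ ≤ h := by
  constructor
  · intro hx
    exact closure_minimal (t := {x : Eu n | inner ℝ x ρ ≤ h}) h2
      (isClosed_le (by fun_prop) (by fun_prop)) hx
  · intro hx
    have hlim : Tendsto (fun k : ℕ => x - (1 / ((k : ℝ) + 1)) • ρ) atTop
        (𝓝 (x - (0 : ℝ) • ρ)) :=
      (tendsto_one_div_add_atTop_nhds_zero_nat.smul_const ρ).const_sub x
    rw [zero_smul, sub_zero] at hlim
    refine mem_closure_of_tendsto hlim (Eventually.of_forall fun k => h1 _ ?_)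
    rw [inner_sub_left, real_inner_smul_left, real_inner_self_eq_norm_sq, hρ]
    have : (0 : ℝ) < 1 / ((k : ℝ) + 1) := by positivity
    linarith

end Hull

end PConductivity

end

/-! ### The reconstruction theorem. -/

open PConductivity

theorem theorem4p1 {n : ℕ} (hn : 2 ≤ n) (p : ℝ) [Fact (1 < p)]
    (Ω : Set (Eu n)) (hΩ : IsOpen Ω) (hΩb : Bornology.IsBounded Ω)
    (σ : Eu n → ℝ) (hσ : LInftyPlus Ω σ)
    (hσ1 : (∀ᵐ x ∂(volume.restrict Ω), 1 ≤ σ x) ∨ (∀ᵐ x ∂(volume.restrict Ω), σ x ≤ 1))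
    (a₀ b₀ : ℝ) (hab : (a₀, b₀) ≠ (0, 0)) :
    (∃ w : ℝ → ℝ, IsWolffProfile p a₀ b₀ w) ∧
    ∀ w : ℝ → ℝ, IsWolffProfile p a₀ b₀ w →
    ∀ perp : Eu n → Eu n, (∀ ρ : Eu n, ‖ρ‖ = 1 → ‖perp ρ‖ = 1 ∧ inner ℝ ρ (perp ρ) = 0) →
      cessco (essSupp Ω (fun x => σ x - 1)) =
          ⋂ (ρ : Eu n) (_ : ‖ρ‖ = 1), closure (blowUpSet p Ω σ w ρ (perp ρ)) ∧
      (volume (essSupp Ω (fun x => σ x - 1)) ≠ 0 → ∀ ρ : Eu n, ‖ρ‖ = 1 →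
        (∀ t : ℝ, essSupportFun (essSupp Ω (fun x => σ x - 1)) ρ < t →
          Tendsto (fun τ : ℝ => indicatorFun p Ω σ w ρ (perp ρ) t τ) atTop (𝓝 0)) ∧
        (∀ t : ℝ, t < essSupportFun (essSupp Ω (fun x => σ x - 1)) ρ →
          ((∀ᵐ x ∂(volume.restrict Ω), 1 ≤ σ x) →
            Tendsto (fun τ : ℝ => indicatorFun p Ω σ w ρ (perp ρ) t τ) atTop atTop) ∧
          ((∀ᵐ x ∂(volume.restrict Ω), σ x ≤ 1) →
            Tendsto (fun τ : ℝ => indicatorFun p Ω σ w ρ (perp ρ) t τ) atTop atBot))) := by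
  have hp : 1 < p := Fact.out
  have hn1 : 1 ≤ n := by omega
  refine ⟨exists_isWolffProfile hp hab, fun w hw perp hperp => ?_⟩
  set D := essSupp Ω (fun x => σ x - 1) with hD
  have hDb : Bornology.IsBounded D := hΩb.subset Set.sdiff_subset
  have hiff : ∀ (ρ : Eu n) (t : ℝ), volume (D \ halfSpace ρ t) = 0 ↔
      ∀ᵐ x ∂(volume.restrict Ω), t < inner ℝ x ρ → σ x = 1 := fun ρ t => by
    rw [hD, volume_essSupp_diff_halfSpace_eq_zero_iff hΩ]
    simp only [sub_eq_zero]
  have hzero : ∀ ρ : Eu n, ‖ρ‖ = 1 → ∀ s t : ℝ, s < t → volume (D \ halfSpace ρ s) = 0 →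
      Tendsto (fun τ : ℝ => indicatorFun p Ω σ w ρ (perp ρ) t τ) atTop (𝓝 0) :=
    fun ρ hρ s t hst hs => hw.tendsto_indicatorFun_zero hn1 hab hΩb hΩ hσ hρ (hperp ρ hρ).1
      (hperp ρ hρ).2 hst ((hiff ρ s).1 hs)
  -- A limit zero contradicts blow-up. No lower bound on `s` is required, so this also covers null
  -- `D`.
  have hnot : ∀ ρ : Eu n, ‖ρ‖ = 1 → ∀ s : ℝ, ∀ x ∈ blowUpSet p Ω σ w ρ (perp ρ),
      volume (D \ halfSpace ρ s) = 0 → inner ℝ x ρ ≤ s := by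
    intro ρ hρ s x hx hs
    by_contra! hlt
    have h1 := (hzero ρ hρ s _ hlt hs).abs
    exact not_tendsto_nhds_of_tendsto_atTop hx _ h1
  have hmain : volume D ≠ 0 → ∀ ρ : Eu n, ‖ρ‖ = 1 →
      (∀ t : ℝ, essSupportFun D ρ < t →
        Tendsto (fun τ : ℝ => indicatorFun p Ω σ w ρ (perp ρ) t τ) atTop (𝓝 0)) ∧
      (∀ t : ℝ, t < essSupportFun D ρ →
        ((∀ᵐ x ∂(volume.restrict Ω), 1 ≤ σ x) →
          Tendsto (fun τ : ℝ => indicatorFun p Ω σ w ρ (perp ρ) t τ) atTop atTop) ∧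
        ((∀ᵐ x ∂(volume.restrict Ω), σ x ≤ 1) →
          Tendsto (fun τ : ℝ => indicatorFun p Ω σ w ρ (perp ρ) t τ) atTop atBot)) := by
    intro hD0 ρ hρ
    refine ⟨fun t ht => ?_, fun t ht => ?_⟩
    · obtain ⟨s, hs, hst⟩ := exists_lt_of_csInf_lt (essSupportFun_set_nonempty hDb ρ hρ) ht
      exact hzero ρ hρ s t hst hs
    · obtain ⟨s, hts, hs⟩ := exists_between ht
      have hs' := fun h => notMem_of_lt_csInf hs (essSupportFun_set_bddBelow hDb hD0 ρ hρ)
        ((hiff ρ s).2 h)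
      exact ⟨fun h1 => hw.tendsto_indicatorFun_atTop hn1 hab hΩb hΩ hσ h1 hρ (hperp ρ hρ).1
        (hperp ρ hρ).2 hts hs', fun h1 => hw.tendsto_indicatorFun_atBot hn1 hab hΩb hΩ hσ h1 hρ
        (hperp ρ hρ).1 (hperp ρ hρ).2 hts hs'⟩
  refine ⟨?_, hmain⟩
  -- For null `D` any real `s` is admissible in `hnot`; taking it below `y·ρ` shows that `H_ρ` is
  -- empty for one unit vector, so both sides are empty.
  by_cases hD0 : volume D = 0
  · rw [cessco_of_volume_eq_zero hD0]
    refine (Set.eq_empty_of_forall_notMem fun x hx => ?_).symm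
    have he : ‖EuclideanSpace.single (⟨0, hn1⟩ : Fin n) (1 : ℝ)‖ = 1 := by simp
    have h1 := Set.mem_iInter₂.1 hx _ he
    have h2 : blowUpSet p Ω σ w (EuclideanSpace.single (⟨0, hn1⟩ : Fin n) (1 : ℝ))
        (perp (EuclideanSpace.single (⟨0, hn1⟩ : Fin n) (1 : ℝ))) = ∅ := by
      refine Set.eq_empty_of_forall_notMem fun y hy => ?_
      have h3 := hnot _ he (inner ℝ y (EuclideanSpace.single (⟨0, hn1⟩ : Fin n) (1 : ℝ)) - 1) y hy
        (measure_mono_null Set.sdiff_subset hD0)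
      linarith
    rw [h2, closure_empty] at h1
    exact h1
  · ext x
    rw [mem_cessco_iff hDb hD0, Set.mem_iInter₂]
    refine forall₂_congr fun ρ hρ => (mem_closure_iff_inner_le hρ (fun y hy => ?_)
      fun y hy => ?_).symm
    · rcases hσ1 with h | h
      · exact tendsto_abs_atTop_atTop.comp (((hmain hD0 ρ hρ).2 _ hy).1 h)
      · exact tendsto_abs_atBot_atTop.comp (((hmain hD0 ρ hρ).2 _ hy).2 h)
    · exact le_csInf (essSupportFun_set_nonempty hDb ρ hρ) fun s hs => hnot ρ hρ s y hy hs
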